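/- Theorem 5.1. All objects are $\mathbb Z_2$-graded (super), and tilde denotes parity. A graded manifold $M$ is a supermanifold glued from coordinate domains whose coordinates $x^a$ (even or odd) carry weights $w_a\in\mathbb Z$ independent of parity. The functions in a chart are smooth in some of the even coordinates of weight $0$ (the base coordinates) and polynomial in all the other coordinates, among them all coordinates of nonzero weight; a chart domain is the product of an open set in the space of the base coordinates with the full space of the remaining coordinates. Coordinate changes preserve parity and weight. Let $M$ be a graded $QS$-manifold, i.e. a graded manifold with * a homological vector field $\hat Q$ (an odd derivation of the sheaf of functions with $\hat Q^2=0$) which is homogeneous of weight $q\in\mathbb Z$; * a Schouten bracket $\{\ ,\ \}_S$ on the sheaf of functions, i.e. an odd bilinear operation with $\{f,g\}_S=-(-1)^{(\tilde f+1)(\tilde g+1)}\{g,f\}_S$, $\{f,\{g,h\}_S\}_S=\{\{f,g\}_S,h\}_S+(-1)^{(\tilde f+1)(\tilde g+1)}\{g,\{f,h\}_S\}_S$ and $\{f,gh\}_S=\{f,g\}_Sh+(-1)^{(\tilde f+1)\tilde g}g\{f,h\}_S$, which is homogeneous of weight $s\in\mathbb Z$, i.e. $w(\{f,g\}_S)=w(f)+w(g)+s$;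 such that $\hat Q\{f,g\}_S=\{\hat Qf,g\}_S+(-1)^{\tilde f+1}\{f,\hat Qg\}_S$. Let $T^*M$ be the cotangent bundle, with local coordinates $x^a,p_a$, where $\tilde p_a=\tilde x^a$ and $p_a=\sum_{a'}\frac{\partial x^{a'}}{\partial x^a}\,p_{a'}$ under a change of coordinates on $M$; functions on $T^*M$ are taken polynomial in the momenta $p_a$. Let $w$ be the induced weight ($w(x^a)=w_a$, $w(p_a)=-w_a$) and $d$ the fiberwise degree ($d(x^a)=0$, $d(p_a)=1$), and give $T^*M$ the total weight $w+(q-s)d$. Let $$\{f,g\}=\sum_a(-1)^{\tilde a(\tilde f+1)}\frac{\partial f}{\partial p_a}\frac{\partial g}{\partial x^a}-(-1)^{\tilde a\tilde f}\frac{\partial f}{\partial x^a}\frac{\partial g}{\partial p_a}$$ be the canonical Poisson bracket on $T^*M$ and $X_H=\{H,\ \}$. Put $Q=\sum_a(\hat Qx^a)\,p_a$ and $S=\tfrac12\sum_{a,b}S^{ab}p_bp_a$, where $\{x^a,x^b\}_S=-(-1)^{\tilde a}S^{ab}$. Then the cotangent coordinate changes are well defined and unique, and with the total weight they make $T^*M$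 a graded manifold. For every $\lambda\in\mathbb R$ the fields $X_Q+\lambda X_S$, given by these formulas in each chart, define a vector field $\hat Q_D$ on $T^*M$ which is homological (odd, $\hat Q_D^2=0$) and homogeneous of weight $q$ with respect to the total weight. Thus the double $DM=T^*M$ with $\hat Q_D$ is a graded $Q$-manifold. -/

import Mathlib

open TopologicalSpace
open scoped TensorProduct ContDiff

noncomputable section

namespace GradedGeometry

/-! ### Smooth functions on open subsets of a coordinate space -/

section SmoothFunctions

variable (B : Type) [Fintype B]

/-- The algebra of smooth real functions on the open set `V` of `ℝ^B`. -/
def Smooth (V : Opens (B → ℝ)) : Subalgebra ℝ (V → ℝ) where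
  carrier := {f | ContDiffOn ℝ ∞ (Function.extend Subtype.val f 0) (V : Set (B → ℝ))}
  mul_mem' := by
    intro f g hf hg
    refine (ContDiffOn.mul hf hg).congr ?_
    intro x hx
    have h := fun k : V → ℝ => Subtype.val_injective.extend_apply k 0 (⟨x, hx⟩ : V)
    simp only at h
    simp [h]
  add_mem' := by
    intro f g hf hg
    refine (ContDiffOn.add hf hg).congr ?_
    intro x hx
    have h := fun k : V → ℝ => Subtype.val_injective.extend_apply k 0 (⟨x, hx⟩ : V)
    simp only at h
    simp [h]
  algebraMap_mem' := by
    intro r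
    refine (contDiffOn_const (c := r)).congr ?_
    intro x hx
    have h := fun k : V → ℝ => Subtype.val_injective.extend_apply k 0 (⟨x, hx⟩ : V)
    simp only at h
    rw [h]
    simp

variable {B}

/-- Restriction of smooth functions to a smaller open set. -/
def Smooth.res {V V' : Opens (B → ℝ)} (h : V' ≤ V) : Smooth B V →ₐ[ℝ] Smooth B V' where
  toFun f := ⟨fun x => f.1 ⟨x.1, h x.2⟩, by
    refine (f.2.mono h).congr ?_
    intro x hx
    have h1 := Subtype.val_injective.extend_apply
      (fun x : V' => f.1 ⟨x.1, h x.2⟩) 0 (⟨x, hx⟩ : V')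
    have h2 := Subtype.val_injective.extend_apply f.1 0 (⟨x, h hx⟩ : V)
    simp only at h1 h2
    rw [h1, h2]⟩
  map_one' := rfl
  map_mul' _ _ := rfl
  map_zero' := rfl
  map_add' _ _ := rfl
  commutes' _ := rfl

/-- The coordinate function `x ↦ x b`. -/
def Smooth.coord (V : Opens (B → ℝ)) (b : B) : Smooth B V :=
  ⟨fun x => x.1 b, by
    refine ((contDiff_apply ℝ ℝ b).contDiffOn).congr ?_
    intro x hx
    exact Subtype.val_injective.extend_apply (fun x : V => x.1 b) 0 (⟨x, hx⟩ : V)⟩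

open Classical in
/-- The partial derivative `∂/∂x^b` of smooth functions. -/
def Smooth.pd (V : Opens (B → ℝ)) (b : B) : Smooth B V →ₗ[ℝ] Smooth B V where
  toFun f := ⟨fun x => fderiv ℝ (Function.extend Subtype.val f.1 0) x.1 (Pi.single b 1), by
    have h1 := (ContDiffOn.fderiv_of_isOpen (m := ∞) f.2 V.isOpen (by simp)).clm_apply
      (contDiffOn_const (c := (Pi.single b 1 : B → ℝ)))
    refine h1.congr ?_
    intro x hx
    exact Subtype.val_injective.extend_apply
      (fun x : V => fderiv ℝ (Function.extend Subtype.val f.1 0) x.1 (Pi.single b 1)) 0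
      (⟨x, hx⟩ : V)⟩
  map_add' := by
    intro f g
    ext x
    have hd : ∀ k : Smooth B V, DifferentiableAt ℝ (Function.extend Subtype.val k.1 0) x.1 :=
      fun k => (ContDiffOn.contDiffAt k.2 (V.isOpen.mem_nhds x.2)).differentiableAt (by simp)
    have he : Function.extend Subtype.val (f + g).1 (0 : (B → ℝ) → ℝ) =
        Function.extend Subtype.val f.1 0 + Function.extend Subtype.val g.1 0 := by
      funext y
      by_cases hy : y ∈ V
      · have h := fun k : V → ℝ => Subtype.val_injective.extend_apply k 0 (⟨y, hy⟩ : V)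
        simp only at h
        simp [h]
      · have h : ¬ ∃ a : V, a.1 = y := by rintro ⟨a, rfl⟩; exact hy a.2
        simp [Function.extend_apply' _ _ _ h]
    change fderiv ℝ (Function.extend Subtype.val (f + g).1 0) x.1 _ = _
    rw [he, fderiv_add (hd f) (hd g)]
    rfl
  map_smul' := by
    intro r f
    ext x
    have he : Function.extend Subtype.val (r • f).1 (0 : (B → ℝ) → ℝ) =
        r • Function.extend Subtype.val f.1 0 := by
      funext y
      by_cases hy : y ∈ V
      · have h := fun k : V → ℝ => Subtype.val_injective.extend_apply k 0 (⟨y, hy⟩ : V)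
        simp only at h
        simp [h]
      · have h : ¬ ∃ a : V, a.1 = y := by rintro ⟨a, rfl⟩; exact hy a.2
        simp [Function.extend_apply' _ _ _ h]
    change fderiv ℝ (Function.extend Subtype.val (r • f).1 0) x.1 _ = _
    rw [he, fderiv_const_smul_field]
    rfl

end SmoothFunctions

/-! ### Graded coordinate systems and their algebras of functions -/

/-- A finite system of coordinates carrying a parity and an integral weight. The coordinates
indexed by `B` are even and of weight zero, and functions are smooth in them; the coordinates
indexed by `Y` (even) and `O` (odd) have the arbitrary weights `wY` and `wO`, and functions are
polynomial in them. -/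
structure Coords where
  B : Type
  Y : Type
  O : Type
  fintypeB : Fintype B
  fintypeY : Fintype Y
  fintypeO : Fintype O
  wY : Y → ℤ
  wO : O → ℤ

attribute [instance] Coords.fintypeB Coords.fintypeY Coords.fintypeO

namespace Coords

/-- The index set of all the coordinates. -/
abbrev Idx (c : Coords) : Type := c.B ⊕ c.Y ⊕ c.O

/-- The parity (`0` or `1`) of a coordinate. -/
def par (c : Coords) : c.Idx → ℕ :=
  Sum.elim (fun _ => 0) (Sum.elim (fun _ => 0) (fun _ => 1))

/-- The weight of a coordinate. -/
def wt (c : Coords) : c.Idx → ℤ :=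
  Sum.elim (fun _ => 0) (Sum.elim c.wY c.wO)

/-- The superalgebra of functions on the superdomain over the open set `V ⊆ ℝ^B`: smooth in the
coordinates `B`, polynomial in the even coordinates `Y` and in the odd coordinates `O`. The first
two tensor factors are purely even, so that the ordinary tensor product is the graded one. -/
def Fn (c : Coords) (V : Opens (c.B → ℝ)) : Type :=
  Smooth c.B V ⊗[ℝ] (MvPolynomial c.Y ℝ ⊗[ℝ] ExteriorAlgebra ℝ (c.O →₀ ℝ))

variable (c : Coords) (V : Opens (c.B → ℝ))

instance : Ring (c.Fn V) :=
  inferInstanceAs (Ring (Smooth c.B V ⊗[ℝ]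
    (MvPolynomial c.Y ℝ ⊗[ℝ] ExteriorAlgebra ℝ (c.O →₀ ℝ))))

instance : Algebra ℝ (c.Fn V) :=
  inferInstanceAs (Algebra ℝ (Smooth c.B V ⊗[ℝ]
    (MvPolynomial c.Y ℝ ⊗[ℝ] ExteriorAlgebra ℝ (c.O →₀ ℝ))))

/-- The functions of the coordinates `B` alone. -/
def ofBase : Smooth c.B V →ₐ[ℝ] c.Fn V :=
  Algebra.TensorProduct.includeLeft (R := ℝ) (S := ℝ) (A := Smooth c.B V)
    (B := MvPolynomial c.Y ℝ ⊗[ℝ] ExteriorAlgebra ℝ (c.O →₀ ℝ))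

/-- The functions that are polynomial in the coordinates `Y` and `O` and do not depend on the
coordinates `B`. -/
def ofFibre : MvPolynomial c.Y ℝ ⊗[ℝ] ExteriorAlgebra ℝ (c.O →₀ ℝ) →ₐ[ℝ] c.Fn V :=
  Algebra.TensorProduct.includeRight (R := ℝ) (A := Smooth c.B V)
    (B := MvPolynomial c.Y ℝ ⊗[ℝ] ExteriorAlgebra ℝ (c.O →₀ ℝ))

/-- The coordinate functions `x^a`. -/
def coord : c.Idx → c.Fn V
  | Sum.inl b => c.ofBase V (Smooth.coord V b)
  | Sum.inr (Sum.inl y) => c.ofFibre V (MvPolynomial.X y ⊗ₜ 1)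
  | Sum.inr (Sum.inr o) => c.ofFibre V (1 ⊗ₜ ExteriorAlgebra.ι ℝ (Finsupp.single o 1))

/-- The left partial derivatives `∂/∂x^a`. -/
def pd : c.Idx → (c.Fn V →ₗ[ℝ] c.Fn V)
  | Sum.inl b => TensorProduct.map (Smooth.pd V b) LinearMap.id
  | Sum.inr (Sum.inl y) => TensorProduct.map LinearMap.id
      (TensorProduct.map (MvPolynomial.pderiv y).toLinearMap LinearMap.id)
  | Sum.inr (Sum.inr o) => TensorProduct.map LinearMap.id
      (TensorProduct.map LinearMap.id
        (CliffordAlgebra.contractLeft (Q := (0 : QuadraticForm ℝ (c.O →₀ ℝ)))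
          (Finsupp.lapply o)))

/-- The parity involution: `f ↦ f` on even functions and `f ↦ -f` on odd functions. -/
def sgn : c.Fn V →ₐ[ℝ] c.Fn V :=
  Algebra.TensorProduct.map (AlgHom.id ℝ _)
    (Algebra.TensorProduct.map (AlgHom.id ℝ _)
      (CliffordAlgebra.involute (Q := (0 : QuadraticForm ℝ (c.O →₀ ℝ)))))

/-- The Euler vector field `∑ w_a x^a ∂/∂x^a` of the weights, the infinitesimal generator of the
scaling transformations `x^a ↦ t^{w_a} x^a`. -/
def euler : c.Fn V →ₗ[ℝ] c.Fn V :=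
  ∑ a : c.Idx, (c.wt a : ℝ) • (LinearMap.mulLeft ℝ (c.coord V a) ∘ₗ c.pd V a)

variable {V}

/-- `f` is homogeneous of parity `n` (modulo 2). -/
def IsPar (n : ℕ) (f : c.Fn V) : Prop := c.sgn V f = (-1 : ℝ) ^ n • f

/-- `f` is homogeneous of weight `w`. -/
def HasWeight (w : ℤ) (f : c.Fn V) : Prop := c.euler V f = (w : ℝ) • f

/-- Restriction of functions to a smaller open set. -/
def res {V V' : Opens (c.B → ℝ)} (h : V' ≤ V) : c.Fn V →ₐ[ℝ] c.Fn V' :=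
  Algebra.TensorProduct.map (Smooth.res h) (AlgHom.id ℝ _)

variable (V)

/-- The value of a function on the base: all coordinates `Y` and `O` are set to zero. -/
def body : c.Fn V →ₐ[ℝ] Smooth c.B V :=
  Algebra.TensorProduct.lift (AlgHom.id ℝ _)
    ((Algebra.ofId ℝ (Smooth c.B V)).comp
      (Algebra.TensorProduct.lift (MvPolynomial.aeval (fun _ => (0 : ℝ)))
        (ExteriorAlgebra.algebraMapInv (R := ℝ) (M := c.O →₀ ℝ))
        (fun _ _ => Commute.all _ _)))
    (fun _ _ => Commute.all _ _)

/-! ### Cotangent coordinates -/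

/-- The coordinates `x^a, p_a` on the cotangent bundle. The parity of `p_a` is that of `x^a`, the
induced weights are `w(x^a) = w_a`, `w(p_a) = -w_a`, the fibrewise degrees are `d(x^a) = 0`,
`d(p_a) = 1`, and the weight of each coordinate is taken to be `w + k d`. Functions are polynomial
in all the momenta. -/
@[reducible] def cot (k : ℤ) : Coords where
  B := c.B
  Y := c.Y ⊕ (c.B ⊕ c.Y)
  O := c.O ⊕ c.O
  fintypeB := inferInstance
  fintypeY := inferInstance
  fintypeO := inferInstance
  wY := Sum.elim (fun y => c.wY y + k * 0)
    (Sum.elim (fun _ => -0 + k * 1) (fun y => -c.wY y + k * 1))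
  wO := Sum.elim (fun o => c.wO o + k * 0) (fun o => -c.wO o + k * 1)

/-- The index of the coordinate `x^a` among the cotangent coordinates. -/
def pos (k : ℤ) : c.Idx → (c.cot k).Idx
  | Sum.inl b => Sum.inl b
  | Sum.inr (Sum.inl y) => Sum.inr (Sum.inl (Sum.inl y))
  | Sum.inr (Sum.inr o) => Sum.inr (Sum.inr (Sum.inl o))

/-- The index of the momentum `p_a` among the cotangent coordinates. -/
def mom (k : ℤ) : c.Idx → (c.cot k).Idx
  | Sum.inl b => Sum.inr (Sum.inl (Sum.inr (Sum.inl b)))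
  | Sum.inr (Sum.inl y) => Sum.inr (Sum.inl (Sum.inr (Sum.inr y)))
  | Sum.inr (Sum.inr o) => Sum.inr (Sum.inr (Sum.inr o))

/-- The momentum `p_a` as a function on the cotangent bundle. -/
def p (k : ℤ) (a : c.Idx) : (c.cot k).Fn V := (c.cot k).coord V (c.mom k a)

/-- The pullback of functions to the cotangent bundle. -/
def pull (k : ℤ) : c.Fn V →ₐ[ℝ] (c.cot k).Fn V :=
  Algebra.TensorProduct.map (AlgHom.id ℝ _)
    (Algebra.TensorProduct.map (MvPolynomial.rename Sum.inl)
      (ExteriorAlgebra.map (Finsupp.lmapDomain ℝ ℝ (Sum.inl : c.O → c.O ⊕ c.O))))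

/-- The Hamiltonian vector field `X_H = {H, ·}` of a function `H` on the cotangent bundle, for the
canonical Poisson bracket
`{f,g} = ∑_a (-1)^{ã(f̃+1)} ∂f/∂p_a ∂g/∂x^a - (-1)^{ã f̃} ∂f/∂x^a ∂g/∂p_a`;
the operator `f ↦ (-1)^{ã f̃} f` is the `ã`-th power of the parity involution. -/
def ham (k : ℤ) (H : (c.cot k).Fn V) : (c.cot k).Fn V →ₗ[ℝ] (c.cot k).Fn V :=
  ∑ a : c.Idx,
    ((-1 : ℝ) ^ c.par a •
        (LinearMap.mulLeft ℝ
            ((c.cot k).pd V (c.mom k a) ((((c.cot k).sgn V) ^ c.par a) H)) ∘ₗ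
          (c.cot k).pd V (c.pos k a))
      - LinearMap.mulLeft ℝ
            ((c.cot k).pd V (c.pos k a) ((((c.cot k).sgn V) ^ c.par a) H)) ∘ₗ
          (c.cot k).pd V (c.mom k a))

variable {V}

/-- The Hamiltonian `p_D = ∑ D^a p_a`, `D^a = D x^a`, of a vector field `D`. -/
def fieldHam (k : ℤ) (D : c.Fn V →ₗ[ℝ] c.Fn V) : (c.cot k).Fn V :=
  ∑ a : c.Idx, c.pull V k (D (c.coord V a)) * c.p V k a

/-- The Hamiltonian `S = (1/2) ∑ S^{ab} p_b p_a` of a Schouten bracket, whose Schouten tensor is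
given by `{x^a, x^b} = -(-1)^ã S^{ab}`. -/
def bracketHam (k : ℤ) (S : c.Fn V →ₗ[ℝ] c.Fn V →ₗ[ℝ] c.Fn V) : (c.cot k).Fn V :=
  (1 / 2 : ℝ) • ∑ a : c.Idx, ∑ b : c.Idx,
    c.pull V k (-((-1 : ℝ) ^ c.par a • S (c.coord V a) (c.coord V b))) *
      c.p V k b * c.p V k a

end Coords

/-! ### Graded manifolds -/

/-- A chart of a graded manifold with base space `X`: a graded coordinate system, together with
a chart of the base with values in the space of the coordinates `B`. -/
structure GChart (X : Type*) [TopologicalSpace X] where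
  coords : Coords
  e : OpenPartialHomeomorph X (coords.B → ℝ)

section Manifold

variable {X : Type*} [TopologicalSpace X]

namespace GChart

/-- The domain of the chart, an open subset of the base. -/
def dom (c : GChart X) : Opens X := ⟨c.e.source, c.e.open_source⟩

/-- The open set of the coordinate space that corresponds to the part of `W` in the domain. -/
def im (c : GChart X) (W : Opens X) : Opens (c.coords.B → ℝ) :=
  ⟨c.e.target ∩ c.e.symm ⁻¹' W, c.e.isOpen_inter_preimage_symm W.isOpen⟩

lemma im_mono (c : GChart X) {W W' : Opens X} (h : W' ≤ W) : c.im W' ≤ c.im W :=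
  fun _ hx => ⟨hx.1, h hx.2⟩

lemma e_mem_im (c : GChart X) {W : Opens X} {x : X} (hW : W ≤ c.dom) (hx : x ∈ W) :
    c.e x ∈ c.im W :=
  ⟨c.e.map_source (hW hx), by
    change c.e.symm (c.e x) ∈ W
    rwa [c.e.left_inv (hW hx)]⟩

/-- The superalgebra of functions over `W`, written in the chart. -/
abbrev Fn (c : GChart X) (W : Opens X) : Type := c.coords.Fn (c.im W)

/-- Restriction of functions. -/
def res (c : GChart X) {W W' : Opens X} (h : W' ≤ W) : c.Fn W →ₐ[ℝ] c.Fn W' :=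
  c.coords.res (c.im_mono h)

/-- The corresponding chart of the cotangent bundle, with the weights `w + k d`. -/
@[reducible] def cot (c : GChart X) (k : ℤ) : GChart X where
  coords := c.coords.cot k
  e := c.e

end GChart

variable {ι : Type*}

/-- Transition data for a family of charts: over every open subset `W` of the common domain of the
charts `i` and `j`, a homomorphism which rewrites functions of the coordinates of the chart `j`
as functions of the coordinates of the chart `i`. -/
abbrev Transitions (c : ι → GChart X) : Type _ :=
  ∀ (i j : ι) (W : Opens X), W ≤ (c i).dom → W ≤ (c j).dom → ((c j).Fn W →ₐ[ℝ] (c i).Fn W)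

/-- The charts and the transitions form an atlas of a graded manifold: the domains cover the base,
and the transitions are isomorphisms of sheaves of algebras over the identity of the base
which preserve parity and weight and satisfy the cocycle condition. -/
structure IsGradedAtlas (c : ι → GChart X) (φ : Transitions c) : Prop where
  cover : ∀ x : X, ∃ i, x ∈ (c i).dom
  map_res : ∀ (i j : ι) (W W' : Opens X) (hi : W ≤ (c i).dom) (hj : W ≤ (c j).dom)
    (h : W' ≤ W) (f : (c j).Fn W),
    φ i j W' (h.trans hi) (h.trans hj) ((c j).res h f) = (c i).res h (φ i j W hi hj f)
  map_body : ∀ (i j : ι) (W : Opens X) (hi : W ≤ (c i).dom) (hj : W ≤ (c j).dom)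
    (f : Smooth (c j).coords.B ((c j).im W)) (x : X) (hx : x ∈ W),
    ((c i).coords.body _ (φ i j W hi hj ((c j).coords.ofBase _ f))).1 ⟨(c i).e x, (c i).e_mem_im hi hx⟩
      = f.1 ⟨(c j).e x, (c j).e_mem_im hj hx⟩
  map_par : ∀ (i j : ι) (W : Opens X) (hi : W ≤ (c i).dom) (hj : W ≤ (c j).dom)
    (n : ℕ) (f : (c j).Fn W), (c j).coords.IsPar n f → (c i).coords.IsPar n (φ i j W hi hj f)
  map_weight : ∀ (i j : ι) (W : Opens X) (hi : W ≤ (c i).dom) (hj : W ≤ (c j).dom)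
    (w : ℤ) (f : (c j).Fn W),
    (c j).coords.HasWeight w f → (c i).coords.HasWeight w (φ i j W hi hj f)
  id : ∀ (i : ι) (W : Opens X) (hi : W ≤ (c i).dom) (f : (c i).Fn W), φ i i W hi hi f = f
  cocycle : ∀ (i j k : ι) (W : Opens X) (hi : W ≤ (c i).dom) (hj : W ≤ (c j).dom)
    (hk : W ≤ (c k).dom) (f : (c k).Fn W),
    φ i j W hi hj (φ j k W hj hk f) = φ i k W hi hk f

/-! ### Vector fields and Schouten brackets -/

/-- A family of linear operators on functions, one over every open subset of each chart. -/
abbrev Operators (c : ι → GChart X) : Type _ :=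
  ∀ (i : ι) (W : Opens X), W ≤ (c i).dom → ((c i).Fn W →ₗ[ℝ] (c i).Fn W)

/-- A family of bilinear operations on functions, one over every open subset of each chart. -/
abbrev Operations (c : ι → GChart X) : Type _ :=
  ∀ (i : ι) (W : Opens X), W ≤ (c i).dom →
    ((c i).Fn W →ₗ[ℝ] (c i).Fn W →ₗ[ℝ] (c i).Fn W)

/-- `D` is a vector field of parity `m`: a derivation of parity `m` of the sheaf of functions. -/
structure IsVectorField (c : ι → GChart X) (φ : Transitions c) (m : ℕ) (D : Operators c) :
    Prop where
  map_res : ∀ (i : ι) (W W' : Opens X) (hi : W ≤ (c i).dom) (h : W' ≤ W) (f : (c i).Fn W),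
    D i W' (h.trans hi) ((c i).res h f) = (c i).res h (D i W hi f)
  map_transition : ∀ (i j : ι) (W : Opens X) (hi : W ≤ (c i).dom) (hj : W ≤ (c j).dom)
    (f : (c j).Fn W), D i W hi (φ i j W hi hj f) = φ i j W hi hj (D j W hj f)
  map_par : ∀ (i : ι) (W : Opens X) (hi : W ≤ (c i).dom) (n : ℕ) (f : (c i).Fn W),
    (c i).coords.IsPar n f → (c i).coords.IsPar (n + m) (D i W hi f)
  leibniz : ∀ (i : ι) (W : Opens X) (hi : W ≤ (c i).dom) (n : ℕ) (f g : (c i).Fn W),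
    (c i).coords.IsPar n f →
      D i W hi (f * g) = D i W hi f * g + (-1 : ℝ) ^ (m * n) • (f * D i W hi g)

/-- `D` is a homological vector field: an odd vector field of square zero. -/
structure IsHomological (c : ι → GChart X) (φ : Transitions c) (D : Operators c) : Prop
    extends IsVectorField c φ 1 D where
  sq_zero : ∀ (i : ι) (W : Opens X) (hi : W ≤ (c i).dom) (f : (c i).Fn W),
    D i W hi (D i W hi f) = 0

/-- The operator family `D` is homogeneous of weight `q`. -/
def FieldHasWeight (c : ι → GChart X) (q : ℤ) (D : Operators c) : Prop :=
  ∀ (i : ι) (W : Opens X) (hi : W ≤ (c i).dom) (w : ℤ) (f : (c i).Fn W),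
    (c i).coords.HasWeight w f → (c i).coords.HasWeight (w + q) (D i W hi f)

/-- `S` is a Schouten (odd Poisson) bracket on the sheaf of functions. -/
structure IsSchouten (c : ι → GChart X) (φ : Transitions c) (S : Operations c) : Prop where
  map_res : ∀ (i : ι) (W W' : Opens X) (hi : W ≤ (c i).dom) (h : W' ≤ W) (f g : (c i).Fn W),
    S i W' (h.trans hi) ((c i).res h f) ((c i).res h g) = (c i).res h (S i W hi f g)
  map_transition : ∀ (i j : ι) (W : Opens X) (hi : W ≤ (c i).dom) (hj : W ≤ (c j).dom)
    (f g : (c j).Fn W),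
    S i W hi (φ i j W hi hj f) (φ i j W hi hj g) = φ i j W hi hj (S j W hj f g)
  map_par : ∀ (i : ι) (W : Opens X) (hi : W ≤ (c i).dom) (m n : ℕ) (f g : (c i).Fn W),
    (c i).coords.IsPar m f → (c i).coords.IsPar n g →
      (c i).coords.IsPar (m + n + 1) (S i W hi f g)
  antisymm : ∀ (i : ι) (W : Opens X) (hi : W ≤ (c i).dom) (m n : ℕ) (f g : (c i).Fn W),
    (c i).coords.IsPar m f → (c i).coords.IsPar n g →
      S i W hi f g = -((-1 : ℝ) ^ ((m + 1) * (n + 1)) • S i W hi g f)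
  jacobi : ∀ (i : ι) (W : Opens X) (hi : W ≤ (c i).dom) (m n : ℕ) (f g h : (c i).Fn W),
    (c i).coords.IsPar m f → (c i).coords.IsPar n g →
      S i W hi f (S i W hi g h) =
        S i W hi (S i W hi f g) h + (-1 : ℝ) ^ ((m + 1) * (n + 1)) • S i W hi g (S i W hi f h)
  leibniz : ∀ (i : ι) (W : Opens X) (hi : W ≤ (c i).dom) (m n : ℕ) (f g h : (c i).Fn W),
    (c i).coords.IsPar m f → (c i).coords.IsPar n g →
      S i W hi f (g * h) = S i W hi f g * h + (-1 : ℝ) ^ ((m + 1) * n) • (g * S i W hi f h)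

/-- The bracket `S` is homogeneous of weight `s`. -/
def BracketHasWeight (c : ι → GChart X) (s : ℤ) (S : Operations c) : Prop :=
  ∀ (i : ι) (W : Opens X) (hi : W ≤ (c i).dom) (v w : ℤ) (f g : (c i).Fn W),
    (c i).coords.HasWeight v f → (c i).coords.HasWeight w g →
      (c i).coords.HasWeight (v + w + s) (S i W hi f g)

/-- The odd field `Q` is a derivation of the Schouten bracket `S`. -/
def IsBracketDerivation (c : ι → GChart X) (Q : Operators c) (S : Operations c) : Prop :=
  ∀ (i : ι) (W : Opens X) (hi : W ≤ (c i).dom) (n : ℕ) (f g : (c i).Fn W),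
    (c i).coords.IsPar n f →
      Q i W hi (S i W hi f g) =
        S i W hi (Q i W hi f) g + (-1 : ℝ) ^ (n + 1) • S i W hi f (Q i W hi g)

/-- A graded `QS`-structure with a homological field `Q` of weight `q` and a Schouten bracket `S`
of weight `s`: the field is a derivation of the bracket. -/
structure IsGradedQS (c : ι → GChart X) (φ : Transitions c) (q s : ℤ)
    (Q : Operators c) (S : Operations c) : Prop where
  homological : IsHomological c φ Q
  field_weight : FieldHasWeight c q Q
  schouten : IsSchouten c φ S
  bracket_weight : BracketHasWeight c s S
  derivation : IsBracketDerivation c Q S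

/-! ### The cotangent bundle -/

/-- The charts of the cotangent bundle, with the weights `w + k d`. -/
@[reducible] def cotCharts (c : ι → GChart X) (k : ℤ) : ι → GChart X := fun i => (c i).cot k

/-- The transitions `Φ` are those of the cotangent bundle: they extend the transitions `φ` of the
manifold, and the momenta transform by `p_b = ∑_a ∂x^a/∂x'^b p'_a`, where `x'^b`, `p_b` belong to
the chart `j`, `x^a`, `p'_a` belong to the chart `i`, and the partial derivatives are computed in
the chart `j` and rewritten in the chart `i`. -/
structure IsCotangent (c : ι → GChart X) (φ : Transitions c) (k : ℤ)
    (Φ : Transitions (cotCharts c k)) : Prop where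
  base : ∀ (i j : ι) (W : Opens X) (hi : W ≤ (c i).dom) (hj : W ≤ (c j).dom) (f : (c j).Fn W),
    Φ i j W hi hj ((c j).coords.pull _ k f) = (c i).coords.pull _ k (φ i j W hi hj f)
  momenta : ∀ (i j : ι) (W : Opens X) (hi : W ≤ (c i).dom) (hj : W ≤ (c j).dom)
    (b : (c j).coords.Idx),
    Φ i j W hi hj ((c j).coords.p _ k b) =
      ∑ a : (c i).coords.Idx,
        (c i).coords.pull _ k
          (φ i j W hi hj
            ((c j).coords.pd _ b (φ j i W hj hi ((c i).coords.coord _ a)))) *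
          (c i).coords.p _ k a

/-- The field `X_Q + l X_S` on the cotangent bundle. -/
def doubleField (c : ι → GChart X) (k : ℤ) (Q : Operators c) (S : Operations c) (l : ℝ) :
    Operators (cotCharts c k) := fun i W hi =>
  (c i).coords.ham _ k ((c i).coords.fieldHam k (Q i W hi))
    + l • (c i).coords.ham _ k ((c i).coords.bracketHam k (S i W hi))

end Manifold

end GradedGeometry

end

/-!
The functions on the cotangent bundle of a chart form a supercommutative algebra with the canonical
Poisson bracket, and every vector field in sight is a superderivation. The proof rests on one
principle: a superderivation is determined by its values on the coordinates (`sder_eq_zero`). For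
the functions of the coordinates `B` this is Hadamard's lemma (`Smooth.eq_zero_of_coord`), and the
remaining coordinates generate. Since both sides are superderivations, the Jacobi identity of the
canonical bracket (`superComm_ham`), its homogeneity (`eulerOf_ham`) and its invariance under
cotangent lifts (`IsCotLift.ham`) need only be checked on coordinates.

A function of nonzero degree in the momenta is determined by its brackets with the functions on
the base (`eq_of_ham_pos`). Hence functions that are linear or quadratic in the momenta can be
compared through their iterated brackets with functions on the base, without coordinates. Write
`p_D` for the Hamiltonian of a vector field `D`, and `S_f = {f, ·}_S` for a function `f` on the
base. Then

* `{p_D, f} = D f` and `{p_D, p_E} = p_[D,E]` (`ham_fieldHam_pull`, `ham_fieldHam_fieldHam`);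
* `{S, f} = -(-1)^f p_{S_f}`, so the Schouten bracket is a derived bracket
  (`ham_bracketHam_pull`);
* `{S, S} = 0` is the Jacobi identity `[S_f, S_g] = S_{{f,g}_S}`, `{p_Q, S} = 0` says that `Q` is a
  derivation of the bracket, and `{p_Q, p_Q} = 0` says `Q^2 = 0`.

So `H = p_Q + λ S` is an odd function with `{H, H} = 0`, and `X_H^2 = X_{{H,H}} / 2 = 0`. The
Hamiltonians `p_Q` and `S` have weights `q + k` and `s + 2 k`, while the bracket has weight `-k`;
these agree exactly for `k = q - s`.

The momenta are the Hamiltonians of the partial derivatives. Their transformation law therefore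
says that they map to the Hamiltonians of the transported fields, and it extends to all vector
fields (`IsCotLift.fieldHam`). Existence of the lifts is the universal property of the algebra of
functions (`exists_algHom`); the cocycle condition and the uniqueness follow because functions on
the base and momenta generate (`cot_algHom_ext`). The field `X_H` does not depend on the chart,
because the lifts are canonical transformations which preserve `p_Q` and `S`.
-/

noncomputable section

namespace GradedGeometry

/-! ### Smooth functions and their derivations -/

section SmoothDerivations

/-- An integral over the unit interval of a smooth function depends smoothly on parameters: it is
the convolution of the smooth family with the indicator function of the interval. -/
lemma contDiff_unitInterval_integral {P : Type*} [NormedAddCommGroup P] [NormedSpace ℝ P]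
    {K : P × ℝ → ℝ} (hK : ContDiff ℝ ∞ K) :
    ContDiff ℝ ∞ fun p => ∫ t in (0 : ℝ)..1, K (p, t) := by
  let χ : ContDiffBump (0 : ℝ) := ⟨1, 2, one_pos, one_lt_two⟩
  let g : P → ℝ → ℝ := fun p u => χ u * K (p, -u)
  let f : ℝ → ℝ := (Set.Ioc (0 : ℝ) 1).indicator 1
  have hf : MeasureTheory.LocallyIntegrable f MeasureTheory.volume := by
    refine ((MeasureTheory.integrable_indicator_iff measurableSet_Ioc).2 ?_).locallyIntegrable
    exact MeasureTheory.integrableOn_const (by simp)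
  have hg : ContDiffOn ℝ ∞ ↿g (Set.univ ×ˢ Set.univ) := by
    refine ContDiff.contDiffOn ?_
    exact (χ.contDiff.comp contDiff_snd).mul
      (hK.comp (contDiff_fst.prodMk contDiff_snd.neg))
  have h := MeasureTheory.contDiffOn_convolution_right_with_param_comp (n := ⊤)
    (μ := MeasureTheory.volume) (ContinuousLinearMap.mul ℝ ℝ)
    (s := (Set.univ : Set P)) (v := fun _ => (0 : ℝ)) contDiffOn_const (f := f) (g := g)
    (k := Metric.closedBall 0 2) isOpen_univ (isCompact_closedBall _ _)
    (fun p u _ hu => by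
      have : χ u = 0 := χ.zero_of_le_dist (by
        rw [Metric.mem_closedBall, not_le] at hu
        exact hu.le)
      simp [g, this]) hf hg
  rw [contDiffOn_univ] at h
  convert h using 2 with p
  rw [intervalIntegral.integral_of_le zero_le_one, ← MeasureTheory.integral_indicator
    measurableSet_Ioc, MeasureTheory.convolution_def]
  congr 1
  funext t
  by_cases ht : t ∈ Set.Ioc (0 : ℝ) 1
  · have : χ (-t) = 1 := χ.one_of_mem_closedBall (by
      simp only [Metric.mem_closedBall, dist_zero_right, norm_neg, Real.norm_eq_abs]
      rw [abs_of_pos ht.1]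
      exact ht.2)
    simp [f, g, ht, this]
  · simp [f, ht]

variable {B : Type} [Fintype B]

open Classical in
/-- Hadamard's lemma. -/
lemma exists_hadamard {F : (B → ℝ) → ℝ} (hF : ContDiff ℝ ∞ F) (x : B → ℝ) :
    ∃ G : B → (B → ℝ) → ℝ, (∀ b, ContDiff ℝ ∞ (G b)) ∧
      ∀ y, F y = F x + ∑ b, (y b - x b) * G b y := by
  let K : B → (B → ℝ) × ℝ → ℝ := fun b z =>
    fderiv ℝ F (x + z.2 • (z.1 - x)) (Pi.single b 1)
  have hline : ContDiff ℝ ∞ fun z : (B → ℝ) × ℝ => x + z.2 • (z.1 - x) :=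
    contDiff_const.add (contDiff_snd.smul (contDiff_fst.sub contDiff_const))
  have hK : ∀ b, ContDiff ℝ ∞ (K b) := fun b =>
    ((hF.fderiv_right (m := ∞) (by simp)).comp hline).clm_apply contDiff_const
  refine ⟨fun b y => ∫ t in (0 : ℝ)..1, K b (y, t),
    fun b => contDiff_unitInterval_integral (hK b), fun y => ?_⟩
  have hcont : ∀ b, Continuous fun t : ℝ => K b (y, t) := fun b =>
    (hK b).continuous.comp (Continuous.prodMk_right y)
  have hd : ∀ t : ℝ, HasDerivAt (fun t : ℝ => F (x + t • (y - x)))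
      (∑ b, (y b - x b) * K b (y, t)) t := by
    intro t
    have h1 : HasDerivAt (fun t : ℝ => x + t • (y - x)) (y - x) t := by
      simpa using ((hasDerivAt_id t).smul_const (y - x)).const_add x
    have h2 := ((hF.differentiable (by simp)).differentiableAt
      (x := x + t • (y - x))).hasFDerivAt.comp_hasDerivAt t h1
    refine h2.congr_deriv ?_
    have h3 := LinearMap.pi_apply_eq_sum_univ
      (fderiv ℝ F (x + t • (y - x))).toLinearMap (y - x)
    simp only [ContinuousLinearMap.coe_coe] at h3
    rw [h3]
    refine Finset.sum_congr rfl fun b _ => ?_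
    have h4 : (fun j => if b = j then (1 : ℝ) else 0) = Pi.single b 1 := by
      funext j
      by_cases hj : b = j
      · subst hj; simp
      · simp [hj]
    rw [h4]
    rfl
  have h := intervalIntegral.integral_eq_sub_of_hasDerivAt (a := 0) (b := 1)
    (fun t _ => hd t) ((continuous_finsetSum _ fun b _ =>
      continuous_const.mul (hcont b)).intervalIntegrable _ _)
  rw [intervalIntegral.integral_finsetSum (f := fun b t => (y b - x b) * K b (y, t)) fun b _ =>
    (continuous_const.mul (hcont b)).intervalIntegrable _ _] at h
  simp only [intervalIntegral.integral_const_mul] at h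
  rw [h]
  simp

namespace Smooth

lemma extend_apply {C : Type*} {V : Opens (C → ℝ)} (f : V → ℝ) (x : V) : Function.extend Subtype.val f 0 x.1 = f x :=
  Subtype.val_injective.extend_apply f 0 x

lemma extend_eventuallyEq {C : Type*} {V : Opens (C → ℝ)} {f : V → ℝ} {F : (C → ℝ) → ℝ} (h : ∀ x : V, f x = F x.1) (x : V) :
    Function.extend Subtype.val f 0 =ᶠ[nhds x.1] F := by
  filter_upwards [V.isOpen.mem_nhds x.2] with y hy
  rw [show y = (⟨y, hy⟩ : V).1 from rfl, extend_apply, h]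

variable {V V' : Opens (B → ℝ)}

/-- The restriction to `V` of a smooth function on the whole space. -/
def ofGlobal (V : Opens (B → ℝ)) (F : (B → ℝ) → ℝ) (hF : ContDiff ℝ ∞ F) : Smooth B V :=
  ⟨fun x => F x.1, hF.contDiffOn.congr fun x hx => extend_apply _ (⟨x, hx⟩ : V)⟩

open Classical in
lemma pd_apply_of_eq (b : B) (f : Smooth B V) {F : (B → ℝ) → ℝ} (h : ∀ x : V, f.1 x = F x.1)
    (x : V) : (pd V b f).1 x = fderiv ℝ F x.1 (Pi.single b 1) := by
  change fderiv ℝ (Function.extend Subtype.val f.1 0) x.1 _ = _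
  rw [(extend_eventuallyEq h x).fderiv_eq]

lemma differentiableAt (f : Smooth B V) (x : V) :
    DifferentiableAt ℝ (Function.extend Subtype.val f.1 0) x.1 :=
  (ContDiffOn.contDiffAt f.2 (V.isOpen.mem_nhds x.2)).differentiableAt (by simp)

lemma pd_mul (b : B) (f g : Smooth B V) :
    pd V b (f * g) = pd V b f * g + f * pd V b g := by
  classical
  ext x
  rw [pd_apply_of_eq b (f * g) (F := Function.extend Subtype.val f.1 0 *
    Function.extend Subtype.val g.1 0) (fun y => by simp) x,
    fderiv_mul (differentiableAt f x) (differentiableAt g x)]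
  simp only [extend_apply, add_apply, smul_apply, smul_eq_mul]
  change f.1 x * (pd V b g).1 x + g.1 x * (pd V b f).1 x = (pd V b f).1 x * g.1 x +
    f.1 x * (pd V b g).1 x
  ring

open Classical in
lemma pd_coord (b b' : B) : pd V b (coord V b') = if b = b' then 1 else 0 := by
  ext x
  rw [pd_apply_of_eq b (coord V b') (F := fun y => y b') (fun y => rfl) x]
  rw [show (fun y : B → ℝ => y b') = (ContinuousLinearMap.proj (R := ℝ) b' :
    (B → ℝ) →L[ℝ] ℝ) from rfl, ContinuousLinearMap.fderiv]
  by_cases h : b = b'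
  · subst h; simp
  · simp [h]

lemma pd_res (h : V' ≤ V) (b : B) (f : Smooth B V) : pd V' b (res h f) = res h (pd V b f) := by
  classical
  ext x
  exact pd_apply_of_eq b (res h f) (F := Function.extend Subtype.val f.1 0)
    (fun y => (extend_apply f.1 (⟨y.1, h y.2⟩ : V)).symm) x

/-- A derivation of the smooth functions at a point is determined by the values on the
coordinates. By Hadamard's lemma this holds for `χ f` and for `χ`, where `χ` is a bump function at
the point, and `f` is treated by the Leibniz rule for the product `χ f`. -/
lemma eq_zero_of_coord (x : V) (L : Smooth B V →ₗ[ℝ] ℝ)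
    (hL : ∀ f g, L (f * g) = L f * g.1 x + f.1 x * L g)
    (hc : ∀ b, L (coord V b) = 0) : L = 0 := by
  have h1 : L 1 = 0 := by
    have := hL 1 1
    simp only [mul_one, OneMemClass.coe_one, Pi.one_apply, one_mul] at this
    linarith
  have hconst : ∀ r : ℝ, L (algebraMap ℝ _ r) = 0 := fun r => by
    rw [Algebra.algebraMap_eq_smul_one, map_smul, h1, smul_zero]
  have hglobal : ∀ (F : (B → ℝ) → ℝ) (hF : ContDiff ℝ ∞ F), L (ofGlobal V F hF) = 0 := by
    intro F hF
    obtain ⟨G, hG, hFG⟩ := exists_hadamard hF x.1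
    have h2 : ofGlobal V F hF = algebraMap ℝ _ (F x.1) +
        ∑ b, (coord V b - algebraMap ℝ _ (x.1 b)) * ofGlobal V (G b) (hG b) := by
      ext y
      simp only [Subalgebra.coe_add, AddSubmonoidClass.coe_finsetSum, Pi.add_apply,
        Finset.sum_apply]
      exact hFG y.1
    rw [h2, map_add, hconst, map_sum, zero_add]
    refine Finset.sum_eq_zero fun b _ => ?_
    rw [hL, map_sub, hc, hconst, sub_zero, zero_mul, zero_add]
    change (x.1 b - x.1 b) * _ = 0
    rw [sub_self, zero_mul]
  obtain ⟨r, hr, hrV⟩ := Metric.isOpen_iff.1 V.isOpen x.1 x.2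
  let χ : ContDiffBump x.1 := ⟨r / 4, r / 2, by positivity, by linarith⟩
  have hχx : χ x.1 = 1 := χ.eventuallyEq_one.eq_of_nhds
  ext f
  let F : (B → ℝ) → ℝ := fun y => χ y * Function.extend Subtype.val f.1 0 y
  have hF : ContDiff ℝ ∞ F := by
    rw [contDiff_iff_contDiffAt]
    intro y
    by_cases hy : y ∈ V
    · exact χ.contDiffAt.mul (ContDiffOn.contDiffAt f.2 (V.isOpen.mem_nhds hy))
    · have hy' : y ∉ Metric.closedBall x.1 (r / 2) := fun hy' =>
        hy (hrV (Metric.closedBall_subset_ball (by linarith) hy'))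
      have h0 : F =ᶠ[nhds y] fun _ => 0 := by
        filter_upwards [Metric.isClosed_closedBall.isOpen_compl.mem_nhds hy'] with z hz
        have : χ z = 0 := χ.zero_of_le_dist (by
          rw [Set.mem_compl_iff, Metric.mem_closedBall, not_le] at hz
          exact hz.le)
        simp [F, this]
      exact contDiffAt_const.congr_of_eventuallyEq h0
  have hmul : ofGlobal V F hF = ofGlobal V χ χ.contDiff * f := by
    ext y
    change χ y.1 * Function.extend Subtype.val f.1 0 y.1 = χ y.1 * f.1 y
    rw [extend_apply]
  have h3 := hL (ofGlobal V χ χ.contDiff) f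
  rw [← hmul, hglobal, hglobal] at h3
  change 0 = 0 * _ + χ x.1 * L f at h3
  rw [hχx] at h3
  simpa using h3.symm

end Smooth

end SmoothDerivations

/-! ### Superalgebras and superderivations -/

section Superalgebra

variable {A : Type*} [Ring A] [Algebra ℝ A]

lemma negOne_pow_mul_self (n : ℕ) : (-1 : ℝ) ^ n * (-1 : ℝ) ^ n = 1 := by
  rw [← mul_pow]; simp

/-- The element `f` is homogeneous of parity `n` (modulo 2) for the parity involution `σ`. -/
def Homog (σ : A →ₐ[ℝ] A) (n : ℕ) (f : A) : Prop := σ f = (-1 : ℝ) ^ n • f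

/-- The algebra is supercommutative for the parity involution `σ`. For `f` of parity `n` and `g`
of parity `m` one has `σ^n g = (-1)^(n m) g`, so that `comm` is the usual sign rule, stated for an
arbitrary second factor. -/
structure IsSuperComm (σ : A →ₐ[ℝ] A) : Prop where
  invol : ∀ f, σ (σ f) = f
  comm : ∀ (n : ℕ) (f g : A), Homog σ n f → f * g = (σ ^ n) g * f

/-- The operator `D` is a superderivation of parity `m`. The sign in the Leibniz rule is produced
by a power of the parity involution, so that the rule holds for all elements. -/
structure SDer (σ : A →ₐ[ℝ] A) (m : ℕ) (D : A →ₗ[ℝ] A) : Prop where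
  par : ∀ f, σ (D f) = (-1 : ℝ) ^ m • D (σ f)
  leibniz : ∀ f g, D (f * g) = D f * g + (σ ^ m) f * D g

/-- The supercommutator of operators of parities `m` and `n`. -/
def superComm (m n : ℕ) (D E : A →ₗ[ℝ] A) : A →ₗ[ℝ] A :=
  D ∘ₗ E - (-1 : ℝ) ^ (m * n) • (E ∘ₗ D)

lemma superComm_apply (m n : ℕ) (D E : A →ₗ[ℝ] A) (f : A) :
    superComm m n D E f = D (E f) - (-1 : ℝ) ^ (m * n) • E (D f) := rfl

variable {σ : A →ₐ[ℝ] A}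

namespace Homog

lemma pow_apply {n : ℕ} {f : A} (h : Homog σ n f) (m : ℕ) :
    (σ ^ m) f = (-1 : ℝ) ^ (m * n) • f := by
  induction m with
  | zero => simp
  | succ m ih =>
    rw [pow_succ, AlgHom.mul_apply, h, map_smul, ih, smul_smul, Nat.succ_mul, pow_add, mul_comm]

lemma congr {m n : ℕ} {f : A} (h : Homog σ m f) (hmn : (-1 : ℝ) ^ m = (-1 : ℝ) ^ n) :
    Homog σ n f := by
  rw [Homog, ← hmn]; exact h

lemma mul {m n : ℕ} {f g : A} (hf : Homog σ m f) (hg : Homog σ n g) : Homog σ (m + n) (f * g) := by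
  rw [Homog, map_mul, hf, hg, smul_mul_smul_comm, pow_add]

lemma add {n : ℕ} {f g : A} (hf : Homog σ n f) (hg : Homog σ n g) : Homog σ n (f + g) := by
  rw [Homog, map_add, hf, hg, smul_add]

lemma smul {n : ℕ} {f : A} (r : ℝ) (hf : Homog σ n f) : Homog σ n (r • f) := by
  rw [Homog, map_smul, hf, smul_comm]

lemma neg {n : ℕ} {f : A} (hf : Homog σ n f) : Homog σ n (-f) := by
  rw [Homog, map_neg, hf, smul_neg]

lemma sub {n : ℕ} {f g : A} (hf : Homog σ n f) (hg : Homog σ n g) : Homog σ n (f - g) := by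
  rw [sub_eq_add_neg]; exact hf.add hg.neg

lemma sum {n : ℕ} {ι : Type*} (s : Finset ι) {f : ι → A} (hf : ∀ i ∈ s, Homog σ n (f i)) :
    Homog σ n (∑ i ∈ s, f i) := by
  rw [Homog, map_sum, Finset.smul_sum]
  exact Finset.sum_congr rfl hf

lemma involution {n : ℕ} {f : A} (hf : Homog σ n f) : Homog σ n (σ f) := by
  rw [Homog, hf, map_smul, hf]

end Homog

namespace IsSuperComm

lemma comm_homog (hσ : IsSuperComm σ) {m n : ℕ} {f g : A} (hf : Homog σ m f) (hg : Homog σ n g) :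
    f * g = (-1 : ℝ) ^ (m * n) • (g * f) := by
  rw [hσ.comm m f g hf, hg.pow_apply, smul_mul_assoc]

lemma exists_homog_add (hσ : IsSuperComm σ) (f : A) : ∃ f₀ f₁, Homog σ 0 f₀ ∧ Homog σ 1 f₁ ∧ f = f₀ + f₁ := by
  refine ⟨(1 / 2 : ℝ) • (f + σ f), (1 / 2 : ℝ) • (f - σ f), Homog.smul _ ?_, Homog.smul _ ?_, ?_⟩
  · rw [Homog, map_add, hσ.invol, pow_zero, one_smul, add_comm]
  · rw [Homog, map_sub, hσ.invol, pow_one, neg_one_smul, neg_sub]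
  · rw [← smul_add, add_add_sub_cancel, ← two_smul ℝ f, smul_smul]
    norm_num

lemma induction_homog (hσ : IsSuperComm σ) {p : A → Prop} (hp : ∀ n f, Homog σ n f → p f)
    (hadd : ∀ f g, p f → p g → p (f + g)) (f : A) : p f := by
  obtain ⟨f₀, f₁, h₀, h₁, rfl⟩ := hσ.exists_homog_add f
  exact hadd _ _ (hp _ _ h₀) (hp _ _ h₁)

end IsSuperComm

/-- The Leibniz rule for homogeneous first factors determines it for all of them. -/
lemma SDer.of_homog (hσ : IsSuperComm σ) {m : ℕ} {D : A →ₗ[ℝ] A}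
    (hpar : ∀ n f, Homog σ n f → Homog σ (n + m) (D f))
    (hmul : ∀ n f g, Homog σ n f → D (f * g) = D f * g + (-1 : ℝ) ^ (m * n) • (f * D g)) :
    SDer σ m D where
  par f := by
    refine hσ.induction_homog (p := fun f => σ (D f) = (-1 : ℝ) ^ m • D (σ f)) (fun n f hf => ?_) (fun f g hf hg => ?_) f
    · rw [hpar n f hf, hf, map_smul, smul_smul, pow_add, mul_comm]
    · simp only [map_add, hf, hg, smul_add]
  leibniz f g := by
    refine hσ.induction_homog (p := fun f => D (f * g) = D f * g + (σ ^ m) f * D g) (fun n f hf => ?_) (fun f f' hf hf' => ?_) f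
    · rw [hmul n f g hf, hf.pow_apply, smul_mul_assoc]
    · simp only [map_add, add_mul, hf, hf']; abel

namespace SDer

variable {m n : ℕ} {D E : A →ₗ[ℝ] A}

lemma homog (hD : SDer σ m D) {f : A} (hf : Homog σ n f) : Homog σ (n + m) (D f) := by
  rw [Homog, hD.par, hf, map_smul, smul_smul, pow_add, mul_comm]

lemma leibniz_homog (hD : SDer σ m D) {f : A} (hf : Homog σ n f) (g : A) :
    D (f * g) = D f * g + (-1 : ℝ) ^ (m * n) • (f * D g) := by
  rw [hD.leibniz, hf.pow_apply, smul_mul_assoc]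

lemma map_one (hD : SDer σ m D) : D 1 = 0 := by
  have h := hD.leibniz 1 1
  simpa using h

lemma map_algebraMap (hD : SDer σ m D) (r : ℝ) : D (algebraMap ℝ A r) = 0 := by
  rw [Algebra.algebraMap_eq_smul_one, map_smul, hD.map_one, smul_zero]

lemma pow_involution (hD : SDer σ m D) (k : ℕ) (f : A) :
    (σ ^ k) (D f) = (-1 : ℝ) ^ (k * m) • D ((σ ^ k) f) := by
  induction k generalizing f with
  | zero => simp
  | succ k ih =>
    rw [pow_succ, AlgHom.mul_apply, AlgHom.mul_apply, hD.par, map_smul, ih, smul_smul,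
      Nat.succ_mul, pow_add, mul_comm]

lemma congr (hD : SDer σ m D) (hσ : IsSuperComm σ) (h : (-1 : ℝ) ^ m = (-1 : ℝ) ^ n) :
    SDer σ n D := by
  refine of_homog hσ (fun k f hf => ?_) fun k f g hf => ?_
  · exact (hD.homog hf).congr (by rw [pow_add, pow_add, h])
  · rw [hD.leibniz_homog hf, pow_mul, h, ← pow_mul]

lemma add (hD : SDer σ m D) (hE : SDer σ m E) : SDer σ m (D + E) where
  par f := by simp only [LinearMap.add_apply, map_add, hD.par, hE.par, smul_add]
  leibniz f g := by
    simp only [LinearMap.add_apply, hD.leibniz, hE.leibniz, add_mul, mul_add]; abel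

lemma smul (r : ℝ) (hD : SDer σ m D) : SDer σ m (r • D) where
  par f := by simp only [LinearMap.smul_apply, map_smul, hD.par, smul_comm r]
  leibniz f g := by
    simp only [LinearMap.smul_apply, hD.leibniz, smul_add, smul_mul_assoc, mul_smul_comm]

lemma zero : SDer σ m (0 : A →ₗ[ℝ] A) where
  par f := by simp
  leibniz f g := by simp

lemma sub (hD : SDer σ m D) (hE : SDer σ m E) : SDer σ m (D - E) := by
  rw [sub_eq_add_neg, ← neg_one_smul ℝ E]
  exact hD.add (hE.smul _)

lemma sum {ι : Type*} (s : Finset ι) {D : ι → A →ₗ[ℝ] A} (h : ∀ i ∈ s, SDer σ m (D i)) :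
    SDer σ m (∑ i ∈ s, D i) := by
  classical
  induction s using Finset.induction_on with
  | empty => simpa using zero
  | insert i s hi ih =>
    rw [Finset.sum_insert hi]
    exact (h i (Finset.mem_insert_self i s)).add
      (ih fun j hj => h j (Finset.mem_insert_of_mem hj))

lemma mulLeft (hσ : IsSuperComm σ) {a : A} (ha : Homog σ n a) (hD : SDer σ m D) :
    SDer σ (n + m) (LinearMap.mulLeft ℝ a ∘ₗ D) where
  par f := by
    simp only [LinearMap.comp_apply, LinearMap.mulLeft_apply, map_mul]
    rw [hD.par, show σ a = _ from ha, smul_mul_smul_comm, pow_add]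
  leibniz f g := by
    simp only [LinearMap.comp_apply, LinearMap.mulLeft_apply]
    rw [hD.leibniz, mul_add, ← mul_assoc, ← mul_assoc, hσ.comm n a ((σ ^ m) f) ha, pow_add,
      AlgHom.mul_apply, mul_assoc ((σ ^ n) _)]

/-- In the Leibniz rule for `[D, E]` the mixed terms `σ^n (D f) * E g` and `σ^m (E f) * D g` cancel
in pairs, after the parity involution has been moved past `D` and `E`. -/
lemma superComm (hD : SDer σ m D) (hE : SDer σ n E) : SDer σ (m + n) (superComm m n D E) where
  par f := by
    simp only [superComm_apply, map_sub, map_smul, hD.par, hE.par, smul_sub, smul_smul, pow_add]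
    ring_nf
  leibniz f g := by
    have h1 := hD.pow_involution n f
    have h2 := hE.pow_involution m f
    simp only [superComm_apply, hD.leibniz, hE.leibniz, map_add]
    rw [h1, h2, ← AlgHom.mul_apply, ← AlgHom.mul_apply, ← pow_add, ← pow_add, add_comm n m,
      mul_comm n m]
    simp only [smul_add, sub_mul, mul_sub, smul_mul_assoc, mul_smul_comm, smul_smul,
      negOne_pow_mul_self, one_smul]
    abel

/-- The transport of a superderivation along mutually inverse even homomorphisms. -/
lemma conj {A' : Type*} [Ring A'] [Algebra ℝ A'] {σ' : A' →ₐ[ℝ] A'} (hD : SDer σ m D)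
    (ψ : A' →ₐ[ℝ] A) (ψ' : A →ₐ[ℝ] A') (hψ : ∀ f, σ (ψ f) = ψ (σ' f))
    (hψ' : ∀ f, σ' (ψ' f) = ψ' (σ f)) (h : ∀ f, ψ' (ψ f) = f) :
    SDer σ' m (ψ'.toLinearMap ∘ₗ D ∘ₗ ψ.toLinearMap) where
  par f := by
    simp only [LinearMap.comp_apply, AlgHom.toLinearMap_apply]
    rw [hψ', hD.par, hψ, map_smul]
  leibniz f g := by
    have h1 : ∀ k : ℕ, ∀ f, (σ ^ k) (ψ f) = ψ ((σ' ^ k) f) := by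
      intro k
      induction k with
      | zero => intro f; rfl
      | succ k ih =>
        intro f
        rw [pow_succ, AlgHom.mul_apply, hψ, ih, pow_succ, AlgHom.mul_apply]
    simp only [LinearMap.comp_apply, AlgHom.toLinearMap_apply]
    rw [map_mul, hD.leibniz, map_add, map_mul, map_mul, h, h1, h]

end SDer

end Superalgebra

/-! ### Functions on superdomains -/

namespace Coords

section SuperDomain

variable (c : Coords) (V : Opens (c.B → ℝ))

/-- The product of a function of the coordinates `B`, a polynomial in the coordinates `Y`, and an
element of the exterior algebra of the coordinates `O`. -/
def tmul (s : Smooth c.B V) (m : MvPolynomial c.Y ℝ) (e : ExteriorAlgebra ℝ (c.O →₀ ℝ)) :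
    c.Fn V := s ⊗ₜ[ℝ] (m ⊗ₜ[ℝ] e)

variable {c V}

lemma tmul_mul (s s' : Smooth c.B V) (m m' : MvPolynomial c.Y ℝ)
    (e e' : ExteriorAlgebra ℝ (c.O →₀ ℝ)) :
    c.tmul V s m e * c.tmul V s' m' e' = c.tmul V (s * s') (m * m') (e * e') := by
  refine (Algebra.TensorProduct.tmul_mul_tmul (R := ℝ) s s' (m ⊗ₜ[ℝ] e) (m' ⊗ₜ[ℝ] e')).trans ?_
  rw [Algebra.TensorProduct.tmul_mul_tmul]
  rfl

lemma ofBase_eq (s : Smooth c.B V) : c.ofBase V s = c.tmul V s 1 1 := rfl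

lemma coord_Y (y : c.Y) :
    c.coord V (Sum.inr (Sum.inl y)) = c.tmul V 1 (MvPolynomial.X y) 1 := rfl

lemma coord_O (o : c.O) : c.coord V (Sum.inr (Sum.inr o)) =
    c.tmul V 1 1 (ExteriorAlgebra.ι ℝ (Finsupp.single o 1)) := rfl

lemma induction_tmul {p : c.Fn V → Prop} (f : c.Fn V) (h : ∀ s m e, p (c.tmul V s m e))
    (hadd : ∀ f g, p f → p g → p (f + g)) (h0 : p 0) : p f := by
  induction f using TensorProduct.induction_on with
  | zero => exact h0
  | add f g hf hg => exact hadd _ _ hf hg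
  | tmul s u =>
    induction u using TensorProduct.induction_on with
    | zero => rw [TensorProduct.tmul_zero]; exact h0
    | add f g hf hg => rw [TensorProduct.tmul_add]; exact hadd _ _ hf hg
    | tmul m e => exact h s m e

/-- The functions of the coordinates `B` together with the coordinates `Y` and `O` generate the
algebra of functions. -/
lemma mem_of_generators (T : Subalgebra ℝ (c.Fn V)) (hB : ∀ s, c.ofBase V s ∈ T)
    (hY : ∀ y, c.coord V (Sum.inr (Sum.inl y)) ∈ T)
    (hO : ∀ o, c.coord V (Sum.inr (Sum.inr o)) ∈ T) (f : c.Fn V) : f ∈ T := by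
  have h1 : ∀ m, c.ofFibre V (m ⊗ₜ 1) ∈ T := by
    intro m
    induction m using MvPolynomial.induction_on with
    | C r => exact (T.comap ((c.ofFibre V).comp Algebra.TensorProduct.includeLeft)).algebraMap_mem r
    | add f g hf hg => rw [TensorProduct.add_tmul, map_add]; exact T.add_mem hf hg
    | mul_X f y hf =>
      have : (f * MvPolynomial.X y) ⊗ₜ[ℝ] (1 : ExteriorAlgebra ℝ (c.O →₀ ℝ)) =
          (f ⊗ₜ 1) * (MvPolynomial.X y ⊗ₜ 1) := by
        rw [Algebra.TensorProduct.tmul_mul_tmul, mul_one]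
      rw [this, map_mul]
      exact T.mul_mem hf (hY y)
  have h2 : ∀ e, c.ofFibre V (1 ⊗ₜ e) ∈ T := by
    intro e
    let j : ExteriorAlgebra ℝ (c.O →₀ ℝ) →ₐ[ℝ] c.Fn V :=
      (c.ofFibre V).comp Algebra.TensorProduct.includeRight
    change j e ∈ T
    induction e using ExteriorAlgebra.induction with
    | algebraMap r => exact (T.comap j).algebraMap_mem r
    | ι v =>
      change v ∈ Submodule.comap (j.toLinearMap ∘ₗ ExteriorAlgebra.ι ℝ) T.toSubmodule
      induction v using Finsupp.induction_linear with
      | zero => exact Submodule.zero_mem _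
      | add f g hf hg => exact Submodule.add_mem _ hf hg
      | single o r =>
        rw [← mul_one r, ← smul_eq_mul, ← Finsupp.smul_single]
        exact Submodule.smul_mem _ _ (hO o)
    | mul f g hf hg => rw [map_mul]; exact T.mul_mem hf hg
    | add f g hf hg => rw [map_add]; exact T.add_mem hf hg
  refine induction_tmul (p := fun f => f ∈ T) f (fun s m e => ?_)
    (fun f g hf hg => T.add_mem hf hg) T.zero_mem
  have : c.tmul V s m e = c.ofBase V s * c.ofFibre V (m ⊗ₜ 1) * c.ofFibre V (1 ⊗ₜ e) := by
    change _ = c.tmul V s 1 1 * c.tmul V 1 m 1 * c.tmul V 1 1 e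
    simp only [tmul_mul, mul_one, one_mul]
  rw [this]
  exact T.mul_mem (T.mul_mem (hB s) (h1 m)) (h2 e)

lemma algHom_ext {C : Type*} [Ring C] [Algebra ℝ C] {F G : c.Fn V →ₐ[ℝ] C}
    (hB : ∀ s, F (c.ofBase V s) = G (c.ofBase V s))
    (hc : ∀ a, F (c.coord V (Sum.inr a)) = G (c.coord V (Sum.inr a))) : F = G := by
  ext f
  exact mem_of_generators (AlgHom.equalizer F G) hB (fun y => hc (Sum.inl y))
    (fun o => hc (Sum.inr o)) f

/-! ### The parity involution and supercommutativity -/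

lemma sgn_tmul (s : Smooth c.B V) (m : MvPolynomial c.Y ℝ) (e : ExteriorAlgebra ℝ (c.O →₀ ℝ)) :
    c.sgn V (c.tmul V s m e) = c.tmul V s m
      (CliffordAlgebra.involute (Q := (0 : QuadraticForm ℝ (c.O →₀ ℝ))) e) := rfl

lemma tmul_neg (s : Smooth c.B V) (m : MvPolynomial c.Y ℝ) (e : ExteriorAlgebra ℝ (c.O →₀ ℝ)) :
    c.tmul V s m (-e) = -c.tmul V s m e := by
  change s ⊗ₜ[ℝ] (m ⊗ₜ[ℝ] (-e)) = -(s ⊗ₜ[ℝ] (m ⊗ₜ[ℝ] e))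
  rw [TensorProduct.tmul_neg, TensorProduct.tmul_neg]

lemma homog_ofBase (s : Smooth c.B V) : Homog (c.sgn V) 0 (c.ofBase V s) := by
  rw [Homog, ofBase_eq, sgn_tmul, map_one, pow_zero, one_smul]

lemma homog_coord (a : c.Idx) : Homog (c.sgn V) (c.par a) (c.coord V a) := by
  rcases a with b | y | o
  · exact homog_ofBase _
  · rw [Homog, coord_Y, sgn_tmul, map_one]
    exact (one_smul _ _).symm
  · rw [Homog, coord_O, sgn_tmul]
    change c.tmul V 1 1 (CliffordAlgebra.involute (CliffordAlgebra.ι _ _)) = (-1 : ℝ) ^ 1 • _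
    rw [CliffordAlgebra.involute_ι, tmul_neg, pow_one, neg_one_smul]

lemma sgn_sgn (f : c.Fn V) : c.sgn V (c.sgn V f) = f := by
  have : (c.sgn V).comp (c.sgn V) = AlgHom.id ℝ _ := by
    refine algHom_ext (fun s => ?_) fun a => ?_
    · rw [AlgHom.comp_apply, (homog_ofBase s).involution]
      simp [show c.sgn V _ = _ from homog_ofBase s]
    · rw [AlgHom.comp_apply, (homog_coord _).involution, show c.sgn V _ = _ from homog_coord _,
        smul_smul, negOne_pow_mul_self, one_smul, AlgHom.id_apply]
  exact DFunLike.congr_fun this f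

lemma commute_ofBase (s : Smooth c.B V) (f : c.Fn V) :
    f * c.ofBase V s = c.ofBase V s * f := by
  refine induction_tmul (p := fun f => f * c.ofBase V s = c.ofBase V s * f) f (fun s' m e => ?_)
    (fun f g hf hg => by rw [add_mul, hf, hg, mul_add]) (by rw [zero_mul, mul_zero])
  rw [ofBase_eq, tmul_mul, tmul_mul, mul_comm s, one_mul, one_mul, mul_one, mul_one]

lemma coord_mul_coord (a b : c.Idx) : c.coord V a * c.coord V b =
    (-1 : ℝ) ^ (c.par a * c.par b) • (c.coord V b * c.coord V a) := by
  rcases b with b | b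
  · change _ = (-1 : ℝ) ^ (c.par a * 0) • _
    rw [mul_zero, pow_zero, one_smul]
    exact commute_ofBase _ _
  rcases a with a | a
  · change _ = (-1 : ℝ) ^ (0 * _) • _
    rw [zero_mul, pow_zero, one_smul]
    exact (commute_ofBase _ _).symm
  rcases a with a | a <;> rcases b with b | b
  · change _ = (-1 : ℝ) ^ 0 • _
    rw [pow_zero, one_smul, coord_Y, coord_Y, tmul_mul, tmul_mul, mul_comm (MvPolynomial.X a)]
  · change _ = (-1 : ℝ) ^ 0 • _
    rw [pow_zero, one_smul, coord_Y, coord_O, tmul_mul, tmul_mul]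
    simp only [one_mul, mul_one]
  · change _ = (-1 : ℝ) ^ 0 • _
    rw [pow_zero, one_smul, coord_Y, coord_O, tmul_mul, tmul_mul]
    simp only [one_mul, mul_one]
  · change _ = (-1 : ℝ) ^ 1 • _
    rw [pow_one, neg_one_smul, coord_O, coord_O, tmul_mul, tmul_mul, ← tmul_neg]
    congr 1
    exact eq_neg_of_add_eq_zero_left (ExteriorAlgebra.ι_add_mul_swap _ _)

/-- Supercommutativity has to be checked on generators only: the elements that satisfy the sign rule
with a fixed generator form a subalgebra, and so do those that satisfy it with a fixed homogeneous
element. -/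
lemma isSuperComm : IsSuperComm (c.sgn V) := by
  refine ⟨sgn_sgn, ?_⟩
  have key : ∀ (k : ℕ) (x f : c.Fn V), Homog (c.sgn V) k x →
      (∀ s, c.ofBase V s * x = x * c.ofBase V s) →
      (∀ a, c.coord V a * x = (-1 : ℝ) ^ (k * c.par a) • (x * c.coord V a)) →
      f * x = x * (c.sgn V ^ k) f := by
    intro k x f hx hB hc
    let T : Subalgebra ℝ (c.Fn V) :=
      { carrier := {f | f * x = x * (c.sgn V ^ k) f}
        mul_mem' := by
          intro f g hf hg
          change f * g * x = x * (c.sgn V ^ k) (f * g)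
          rw [mul_assoc, show g * x = _ from hg, ← mul_assoc, show f * x = _ from hf, map_mul,
            mul_assoc]
        add_mem' := by
          intro f g hf hg
          change (f + g) * x = x * (c.sgn V ^ k) (f + g)
          rw [add_mul, show g * x = _ from hg, show f * x = _ from hf, map_add, mul_add]
        algebraMap_mem' := by
          intro r
          change algebraMap ℝ _ r * x = x * (c.sgn V ^ k) (algebraMap ℝ _ r)
          rw [AlgHom.commutes, Algebra.commutes] }
    have hT : ∀ a, c.coord V a ∈ T := fun a => by
      change c.coord V a * x = x * (c.sgn V ^ k) (c.coord V a)
      rw [hc, (homog_coord a).pow_apply, mul_smul_comm]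
    refine mem_of_generators T (fun s => ?_) (fun y => hT _) (fun o => hT _) f
    change c.ofBase V s * x = x * (c.sgn V ^ k) (c.ofBase V s)
    rw [hB, (homog_ofBase s).pow_apply, mul_zero, pow_zero, one_smul]
  intro n f g hf
  let T : Subalgebra ℝ (c.Fn V) :=
    { carrier := {g | f * g = (c.sgn V ^ n) g * f}
      mul_mem' := by
        intro g h hg hh
        change f * (g * h) = (c.sgn V ^ n) (g * h) * f
        rw [← mul_assoc, show f * g = _ from hg, mul_assoc, show f * h = _ from hh, map_mul,
          mul_assoc]
      add_mem' := by
        intro g h hg hh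
        change f * (g + h) = (c.sgn V ^ n) (g + h) * f
        rw [mul_add, show f * g = _ from hg, show f * h = _ from hh, map_add, add_mul]
      algebraMap_mem' := by
        intro r
        change f * algebraMap ℝ _ r = (c.sgn V ^ n) (algebraMap ℝ _ r) * f
        rw [AlgHom.commutes, Algebra.commutes] }
  have hT : ∀ a, c.coord V a ∈ T := fun a => by
    change f * c.coord V a = (c.sgn V ^ n) (c.coord V a) * f
    rw [key (c.par a) (c.coord V a) f (homog_coord a) (fun s => (commute_ofBase _ _).symm)
      (fun b => by rw [coord_mul_coord, mul_comm (c.par b)]), hf.pow_apply,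
      (homog_coord a).pow_apply, mul_smul_comm, smul_mul_assoc, mul_comm n]
  refine mem_of_generators T (fun s => ?_) (fun y => hT _) (fun o => hT _) g
  change f * c.ofBase V s = (c.sgn V ^ n) (c.ofBase V s) * f
  rw [commute_ofBase, (homog_ofBase s).pow_apply, mul_zero, pow_zero, one_smul]

/-! ### The partial derivatives -/

lemma pd_B_tmul (b : c.B) (s : Smooth c.B V) (m : MvPolynomial c.Y ℝ)
    (e : ExteriorAlgebra ℝ (c.O →₀ ℝ)) :
    c.pd V (Sum.inl b) (c.tmul V s m e) = c.tmul V (Smooth.pd V b s) m e := rfl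

lemma pd_Y_tmul (y : c.Y) (s : Smooth c.B V) (m : MvPolynomial c.Y ℝ)
    (e : ExteriorAlgebra ℝ (c.O →₀ ℝ)) :
    c.pd V (Sum.inr (Sum.inl y)) (c.tmul V s m e) = c.tmul V s (MvPolynomial.pderiv y m) e := rfl

lemma pd_O_tmul (o : c.O) (s : Smooth c.B V) (m : MvPolynomial c.Y ℝ)
    (e : ExteriorAlgebra ℝ (c.O →₀ ℝ)) :
    c.pd V (Sum.inr (Sum.inr o)) (c.tmul V s m e) = c.tmul V s m
      (CliffordAlgebra.contractLeft (Q := (0 : QuadraticForm ℝ (c.O →₀ ℝ)))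
        (Finsupp.lapply o) e) := rfl

/-- Contraction with a linear form is an odd derivation of the Clifford algebra. -/
lemma contractLeft_mul {M : Type*} [AddCommGroup M] [Module ℝ M] {Q : QuadraticForm ℝ M}
    (d : Module.Dual ℝ M) (a b : CliffordAlgebra Q) :
    CliffordAlgebra.contractLeft d (a * b) = CliffordAlgebra.contractLeft d a * b +
      CliffordAlgebra.involute a * CliffordAlgebra.contractLeft d b := by
  induction a using CliffordAlgebra.left_induction with
  | algebraMap r =>
    rw [CliffordAlgebra.contractLeft_algebraMap_mul, CliffordAlgebra.contractLeft_algebraMap,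
      AlgHom.commutes, zero_mul, zero_add]
  | add f g hf hg => simp only [add_mul, map_add, hf, hg]; abel
  | ι_mul x v hx =>
    rw [mul_assoc, CliffordAlgebra.contractLeft_ι_mul, hx, CliffordAlgebra.contractLeft_ι_mul,
      map_mul, CliffordAlgebra.involute_ι, mul_add, sub_mul, smul_mul_assoc]
    simp only [neg_mul, mul_assoc]
    abel

lemma contractLeft_involute {M : Type*} [AddCommGroup M] [Module ℝ M] {Q : QuadraticForm ℝ M}
    (d : Module.Dual ℝ M) (a : CliffordAlgebra Q) :
    CliffordAlgebra.involute (CliffordAlgebra.contractLeft d a) =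
      -CliffordAlgebra.contractLeft d (CliffordAlgebra.involute a) := by
  induction a using CliffordAlgebra.left_induction with
  | algebraMap r => simp
  | add f g hf hg => simp only [map_add, hf, hg]; abel
  | ι_mul x v hx =>
    simp only [CliffordAlgebra.contractLeft_ι_mul, map_sub, map_smul, map_mul,
      CliffordAlgebra.involute_ι, hx, neg_mul, map_neg, mul_neg, neg_neg]

/-- The partial derivative along a coordinate is a superderivation of the parity of the coordinate. -/
lemma sder_pd (a : c.Idx) : SDer (c.sgn V) (c.par a) (c.pd V a) := by
  have par_of : ∀ (D : c.Fn V →ₗ[ℝ] c.Fn V) (m : ℕ),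
      (∀ s k e, c.sgn V (D (c.tmul V s k e)) = (-1 : ℝ) ^ m • D (c.sgn V (c.tmul V s k e))) →
      ∀ f, c.sgn V (D f) = (-1 : ℝ) ^ m • D (c.sgn V f) := fun D m h f =>
    induction_tmul (p := fun f => c.sgn V (D f) = (-1 : ℝ) ^ m • D (c.sgn V f)) f h
      (fun f g hf hg => by simp only [map_add, hf, hg, smul_add]) (by simp)
  have mul_of : ∀ (D : c.Fn V →ₗ[ℝ] c.Fn V) (m : ℕ),
      (∀ s k e s' k' e', D (c.tmul V s k e * c.tmul V s' k' e') =
        D (c.tmul V s k e) * c.tmul V s' k' e' +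
          (c.sgn V ^ m) (c.tmul V s k e) * D (c.tmul V s' k' e')) →
      ∀ f g, D (f * g) = D f * g + (c.sgn V ^ m) f * D g := fun D m h f g =>
    induction_tmul (p := fun f => D (f * g) = D f * g + (c.sgn V ^ m) f * D g) f
      (fun s k e => induction_tmul (p := fun g => D (c.tmul V s k e * g) =
          D (c.tmul V s k e) * g + (c.sgn V ^ m) (c.tmul V s k e) * D g) g
        (fun s' k' e' => h s k e s' k' e')
        (fun f g hf hg => by simp only [mul_add, map_add, hf, hg]; abel) (by simp))
      (fun f f' hf hf' => by simp only [add_mul, map_add, hf, hf']; abel) (by simp)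
  rcases a with b | y | o
  · refine ⟨par_of _ _ fun s k e => ?_, mul_of _ _ fun s k e s' k' e' => ?_⟩
    · change _ = (-1 : ℝ) ^ 0 • _
      rw [pow_zero, one_smul]; rfl
    · change _ = _ + c.tmul V s k e * _
      rw [tmul_mul, pd_B_tmul, pd_B_tmul, pd_B_tmul, tmul_mul, tmul_mul, Smooth.pd_mul]
      exact TensorProduct.add_tmul _ _ _
  · refine ⟨par_of _ _ fun s k e => ?_, mul_of _ _ fun s k e s' k' e' => ?_⟩
    · change _ = (-1 : ℝ) ^ 0 • _
      rw [pow_zero, one_smul]; rfl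
    · change _ = _ + c.tmul V s k e * _
      rw [tmul_mul, pd_Y_tmul, pd_Y_tmul, pd_Y_tmul, tmul_mul, tmul_mul, Derivation.leibniz,
        smul_eq_mul, smul_eq_mul, mul_comm k', add_comm]
      change (s * s') ⊗ₜ[ℝ] ((_ + _) ⊗ₜ[ℝ] (e * e')) = _
      rw [TensorProduct.add_tmul, TensorProduct.tmul_add]
      rfl
  · refine ⟨par_of _ _ fun s k e => ?_, mul_of _ _ fun s k e s' k' e' => ?_⟩
    · change _ = (-1 : ℝ) ^ 1 • _
      rw [pow_one, neg_one_smul, pd_O_tmul, sgn_tmul, sgn_tmul, pd_O_tmul, ← tmul_neg]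
      congr 1
      exact contractLeft_involute _ _
    · change _ = _ + c.sgn V (c.tmul V s k e) * _
      rw [tmul_mul, pd_O_tmul, pd_O_tmul, pd_O_tmul, sgn_tmul, tmul_mul, tmul_mul]
      erw [contractLeft_mul]
      change (s * s') ⊗ₜ[ℝ] ((k * k') ⊗ₜ[ℝ] (_ + _)) = _
      rw [TensorProduct.tmul_add, TensorProduct.tmul_add]
      rfl

lemma pd_B_ofBase (b : c.B) (s : Smooth c.B V) :
    c.pd V (Sum.inl b) (c.ofBase V s) = c.ofBase V (Smooth.pd V b s) := rfl

lemma pd_inr_ofBase (a : c.Y ⊕ c.O) (s : Smooth c.B V) :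
    c.pd V (Sum.inr a) (c.ofBase V s) = 0 := by
  rcases a with y | o
  · rw [ofBase_eq, pd_Y_tmul, MvPolynomial.pderiv_one]
    change s ⊗ₜ[ℝ] ((0 : MvPolynomial c.Y ℝ) ⊗ₜ[ℝ] _) = 0
    rw [TensorProduct.zero_tmul, TensorProduct.tmul_zero]
  · rw [ofBase_eq, pd_O_tmul]
    erw [CliffordAlgebra.contractLeft_one (Q := (0 : QuadraticForm ℝ (c.O →₀ ℝ)))]
    change s ⊗ₜ[ℝ] (_ ⊗ₜ[ℝ] (0 : ExteriorAlgebra ℝ (c.O →₀ ℝ))) = 0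
    rw [TensorProduct.tmul_zero, TensorProduct.tmul_zero]

open Classical in
lemma pd_coord (a b : c.Idx) : c.pd V a (c.coord V b) = if a = b then 1 else 0 := by
  rcases b with b | b
  · change c.pd V a (c.ofBase V _) = _
    rcases a with a | a
    · rw [pd_B_ofBase, Smooth.pd_coord]
      by_cases h : a = b
      · rw [if_pos h, if_pos (by rw [h]), map_one]
      · rw [if_neg h, if_neg (fun h' => h (Sum.inl_injective h')), map_zero]
    · rw [pd_inr_ofBase, if_neg (by simp)]
  have hz1 : ∀ m e, c.tmul V 0 m e = 0 := fun m e => TensorProduct.zero_tmul _ _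
  have hz2 : ∀ s e, c.tmul V s 0 e = 0 := fun s e => by
    change s ⊗ₜ[ℝ] ((0 : MvPolynomial c.Y ℝ) ⊗ₜ[ℝ] _) = 0
    rw [TensorProduct.zero_tmul, TensorProduct.tmul_zero]
  have hz3 : ∀ s m, c.tmul V s m 0 = 0 := fun s m => by
    change s ⊗ₜ[ℝ] (m ⊗ₜ[ℝ] (0 : ExteriorAlgebra ℝ (c.O →₀ ℝ))) = 0
    rw [TensorProduct.tmul_zero, TensorProduct.tmul_zero]
  have h1 : ∀ b : c.B, Smooth.pd V b 1 = 0 := fun b => by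
    have := Smooth.pd_mul (V := V) b 1 1
    rwa [mul_one, mul_one, one_mul, left_eq_add] at this
  have hc1 : ∀ o : c.O, CliffordAlgebra.contractLeft (Q := (0 : QuadraticForm ℝ (c.O →₀ ℝ)))
      (Finsupp.lapply o) (1 : ExteriorAlgebra ℝ (c.O →₀ ℝ)) = 0 := fun o =>
    CliffordAlgebra.contractLeft_one (Q := (0 : QuadraticForm ℝ (c.O →₀ ℝ))) _
  rcases a with a | a | a <;> rcases b with b | b
  · rw [coord_Y, pd_B_tmul, h1, hz1]; simp
  · rw [coord_O, pd_B_tmul, h1, hz1]; simp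
  · rw [coord_Y, pd_Y_tmul, MvPolynomial.pderiv_X]
    by_cases h : a = b
    · subst h; simp; rfl
    · rw [Pi.single_eq_of_ne (Ne.symm h), hz2]; simp [h]
  · rw [coord_O, pd_Y_tmul, MvPolynomial.pderiv_one, hz2]; simp
  · rw [coord_Y, pd_O_tmul, hc1, hz3]; simp
  · rw [coord_O, pd_O_tmul]
    have : CliffordAlgebra.contractLeft (Q := (0 : QuadraticForm ℝ (c.O →₀ ℝ)))
        (Finsupp.lapply a) (ExteriorAlgebra.ι ℝ (Finsupp.single b 1)) =
        algebraMap ℝ (ExteriorAlgebra ℝ (c.O →₀ ℝ)) (Finsupp.single b (1 : ℝ) a) :=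
      CliffordAlgebra.contractLeft_ι (0 : QuadraticForm ℝ (c.O →₀ ℝ)) _ _
    rw [this]
    by_cases h : a = b
    · subst h; simp; rfl
    · rw [Finsupp.single_eq_of_ne h, map_zero, hz3]; simp [h]

end SuperDomain

end Coords

namespace Coords

section Generation

variable {c : Coords} {V V' : Opens (c.B → ℝ)}

/-! ### Superderivations of the functions on a superdomain -/

/-- A superderivation is determined by its values on the coordinates: the coefficients of its
values on functions of the coordinates `B` are point derivations at every point. -/
lemma sder_eq_zero {m : ℕ} {D : c.Fn V →ₗ[ℝ] c.Fn V} (hD : SDer (c.sgn V) m D)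
    (h : ∀ a, D (c.coord V a) = 0) : D = 0 := by
  have hB : ∀ s, D (c.ofBase V s) = 0 := by
    classical
    let bas := Module.Basis.ofVectorSpace ℝ
      (MvPolynomial c.Y ℝ ⊗[ℝ] ExteriorAlgebra ℝ (c.O →₀ ℝ))
    let Θ := TensorProduct.equivFinsuppOfBasisRight (M := Smooth c.B V) bas
    let ev : V → _ → c.Fn V →ₗ[ℝ] ℝ := fun x i =>
      (LinearMap.proj x ∘ₗ (Smooth c.B V).val.toLinearMap) ∘ₗ Finsupp.lapply i ∘ₗ Θ.toLinearMap
    have hev : ∀ x i s f, ev x i (c.ofBase V s * f) = s.1 x * ev x i f := by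
      intro x i s f
      refine induction_tmul (p := fun f => ev x i (c.ofBase V s * f) = s.1 x * ev x i f) f
        (fun s' k e => ?_) (fun f g hf hg => by rw [mul_add, map_add, map_add, hf, hg, mul_add])
        (by rw [mul_zero, map_zero, mul_zero])
      rw [ofBase_eq, tmul_mul, one_mul, one_mul]
      change (Θ ((s * s') ⊗ₜ (k ⊗ₜ e)) i).1 x = s.1 x * (Θ (s' ⊗ₜ (k ⊗ₜ e)) i).1 x
      rw [TensorProduct.equivFinsuppOfBasisRight_apply_tmul_apply,
        TensorProduct.equivFinsuppOfBasisRight_apply_tmul_apply]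
      change (_ : ℝ) • (s.1 x * s'.1 x) = s.1 x * ((_ : ℝ) • s'.1 x)
      rw [mul_smul_comm]
    have hL : ∀ x i, ev x i ∘ₗ D ∘ₗ (c.ofBase V).toLinearMap = 0 := by
      intro x i
      refine Smooth.eq_zero_of_coord x _ (fun f g => ?_) fun b => ?_
      · simp only [LinearMap.comp_apply, AlgHom.toLinearMap_apply]
        rw [map_mul, hD.leibniz_homog (homog_ofBase f), mul_zero, pow_zero, one_smul,
          commute_ofBase, map_add, hev, hev, mul_comm (g.1 x)]
      · change ev x i (D (c.coord V (Sum.inl b))) = 0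
        rw [h, map_zero]
    intro s
    -- The functionals `ev x i` separate the elements of the tensor product.
    refine (LinearEquiv.map_eq_zero_iff Θ).1 ?_
    ext i x
    exact LinearMap.congr_fun (hL x i) s
  let T : Subalgebra ℝ (c.Fn V) :=
    { carrier := {f | D f = 0}
      mul_mem' := by
        intro f g hf hg
        change D (f * g) = 0
        rw [hD.leibniz, show D f = 0 from hf, show D g = 0 from hg, zero_mul, mul_zero, zero_add]
      add_mem' := by
        intro f g hf hg
        change D (f + g) = 0
        rw [map_add, show D f = 0 from hf, show D g = 0 from hg, zero_add]
      algebraMap_mem' := hD.map_algebraMap }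
  ext f
  exact mem_of_generators T hB (fun y => h _) (fun o => h _) f

lemma sder_ext {m : ℕ} {D E : c.Fn V →ₗ[ℝ] c.Fn V} (hD : SDer (c.sgn V) m D)
    (hE : SDer (c.sgn V) m E) (h : ∀ a, D (c.coord V a) = E (c.coord V a)) : D = E := by
  rw [← sub_eq_zero]
  exact sder_eq_zero (hD.sub hE) fun a => by rw [LinearMap.sub_apply, h, sub_self]

lemma superComm_eq_zero {m n : ℕ} {D E : c.Fn V →ₗ[ℝ] c.Fn V} (h : superComm m n D E = 0)
    (f : c.Fn V) : D (E f) = (-1 : ℝ) ^ (m * n) • E (D f) :=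
  sub_eq_zero.1 (LinearMap.congr_fun h f)

lemma map_one_or_zero {m : ℕ} {D : c.Fn V →ₗ[ℝ] c.Fn V} (hD : SDer (c.sgn V) m D) (P : Prop)
    [Decidable P] : D (if P then 1 else 0) = 0 := by
  split_ifs
  · exact hD.map_one
  · exact map_zero D

lemma pd_pd (a b : c.Idx) (f : c.Fn V) :
    c.pd V a (c.pd V b f) = (-1 : ℝ) ^ (c.par a * c.par b) • c.pd V b (c.pd V a f) := by
  classical
  refine superComm_eq_zero (sder_eq_zero ((sder_pd a).superComm (sder_pd b)) fun z => ?_) f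
  rw [superComm_apply, pd_coord, pd_coord, map_one_or_zero (sder_pd a),
    map_one_or_zero (sder_pd b), smul_zero, sub_zero]

/-- The parities of `u` and of the partial derivative add up to `m` modulo 2. -/
lemma sder_mul_pd {m : ℕ} (a : c.Idx) {u : c.Fn V} (hu : Homog (c.sgn V) (c.par a + m) u) :
    SDer (c.sgn V) m (LinearMap.mulLeft ℝ u ∘ₗ c.pd V a) :=
  (SDer.mulLeft isSuperComm hu (sder_pd a)).congr isSuperComm (by
    rw [pow_add, pow_add, mul_right_comm, negOne_pow_mul_self, one_mul])

/-- A superderivation is a combination of the partial derivatives. -/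
lemma sder_apply {m : ℕ} {D : c.Fn V →ₗ[ℝ] c.Fn V} (hD : SDer (c.sgn V) m D) (f : c.Fn V) :
    D f = ∑ a, D (c.coord V a) * c.pd V a f := by
  classical
  have h : D = ∑ a, LinearMap.mulLeft ℝ (D (c.coord V a)) ∘ₗ c.pd V a := by
    refine sder_ext hD (SDer.sum _ fun a _ => sder_mul_pd a (hD.homog (homog_coord a))) fun b => ?_
    simp only [LinearMap.sum_apply, LinearMap.comp_apply, LinearMap.mulLeft_apply, pd_coord,
      mul_ite, mul_one, mul_zero, Finset.sum_ite_eq', Finset.mem_univ, if_true]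
  conv_lhs => rw [h]
  rw [LinearMap.sum_apply]
  rfl

/-- The Euler vector field for real weights `ν` of the coordinates. -/
def eulerOf (c : Coords) (V : Opens (c.B → ℝ)) (ν : c.Idx → ℝ) : c.Fn V →ₗ[ℝ] c.Fn V :=
  ∑ a : c.Idx, ν a • (LinearMap.mulLeft ℝ (c.coord V a) ∘ₗ c.pd V a)

lemma eulerOf_apply (ν : c.Idx → ℝ) (f : c.Fn V) :
    c.eulerOf V ν f = ∑ a, ν a • (c.coord V a * c.pd V a f) := by
  rw [eulerOf, LinearMap.sum_apply]
  rfl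

lemma sder_eulerOf (ν : c.Idx → ℝ) : SDer (c.sgn V) 0 (c.eulerOf V ν) := by
  unfold eulerOf
  refine SDer.sum _ fun a _ => SDer.smul _ (sder_mul_pd (m := 0) a ?_)
  rw [add_zero]
  exact homog_coord a

lemma eulerOf_coord (ν : c.Idx → ℝ) (a : c.Idx) :
    c.eulerOf V ν (c.coord V a) = ν a • c.coord V a := by
  classical
  simp only [eulerOf_apply, pd_coord, mul_ite, mul_one, mul_zero, smul_ite, smul_zero,
    Finset.sum_ite_eq', Finset.mem_univ, if_true]

/-- Products add weights. -/
lemma eulerOf_mul (ν : c.Idx → ℝ) {v w : ℝ} {f g : c.Fn V} (hf : c.eulerOf V ν f = v • f)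
    (hg : c.eulerOf V ν g = w • g) : c.eulerOf V ν (f * g) = (v + w) • (f * g) := by
  rw [(sder_eulerOf ν).leibniz, pow_zero, AlgHom.one_apply, hf, hg, smul_mul_assoc,
    mul_smul_comm, add_smul]

lemma eulerOf_pd (ν : c.Idx → ℝ) {w : ℝ} {f : c.Fn V} (hf : c.eulerOf V ν f = w • f) (a : c.Idx) :
    c.eulerOf V ν (c.pd V a f) = (w - ν a) • c.pd V a f := by
  classical
  have h : superComm 0 (c.par a) (c.eulerOf V ν) (c.pd V a) = (-ν a) • c.pd V a := by
    refine sder_ext ((sder_eulerOf ν).superComm (sder_pd a))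
      (((sder_pd a).smul _).congr isSuperComm (by rw [zero_add])) fun b => ?_
    rw [superComm_apply, eulerOf_coord, map_smul, LinearMap.smul_apply, pd_coord,
      map_one_or_zero (sder_eulerOf ν), zero_mul, pow_zero, one_smul, zero_sub, neg_smul]
    by_cases hab : a = b
    · rw [hab]
    · simp [hab]
  have h1 := LinearMap.congr_fun h f
  rw [superComm_apply, hf, map_smul, zero_mul, pow_zero, one_smul, LinearMap.smul_apply,
    sub_eq_iff_eq_add, ← add_smul] at h1
  rw [h1]
  congr 1
  ring

/-! ### Homomorphisms out of the functions on a superdomain -/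

/-- Polynomials can be evaluated at even elements of a supercommutative algebra, because these form
a commutative subalgebra. -/
lemma exists_even_lift {C : Type*} [Ring C] [Algebra ℝ C] {τ : C →ₐ[ℝ] C} (hτ : IsSuperComm τ)
    {Y : Type*} (y : Y → C) (hy : ∀ i, Homog τ 0 (y i)) :
    ∃ γ : MvPolynomial Y ℝ →ₐ[ℝ] C, (∀ i, γ (MvPolynomial.X i) = y i) ∧
      ∀ k, Homog τ 0 (γ k) := by
  let E : Subalgebra ℝ C := AlgHom.equalizer τ (AlgHom.id ℝ C)
  have hE : ∀ u : C, u ∈ E ↔ Homog τ 0 u := fun u => by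
    rw [Homog, pow_zero, one_smul]
    exact AlgHom.mem_equalizer τ (AlgHom.id ℝ C) u
  let instE : CommRing E :=
    { (inferInstance : Ring E) with
      mul_comm := fun u v => Subtype.ext (hτ.comm 0 u.1 v.1 ((hE _).1 u.2)) }
  let γ : MvPolynomial Y ℝ →ₐ[ℝ] E := MvPolynomial.aeval fun i => ⟨y i, (hE _).2 (hy i)⟩
  exact ⟨E.val.comp γ, fun i => by simp [γ], fun k => (hE _).1 (γ k).2⟩

/-- Homomorphisms to a supercommutative algebra with prescribed even values on the coordinates `Y`
and odd values on the coordinates `O`, extending a given homomorphism on the functions of the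
coordinates `B`. -/
lemma exists_algHom {C : Type*} [Ring C] [Algebra ℝ C] {τ : C →ₐ[ℝ] C} (hτ : IsSuperComm τ)
    (β : Smooth c.B V →ₐ[ℝ] C) (hβ : ∀ s, Homog τ 0 (β s)) (z : c.Y ⊕ c.O → C)
    (hz : ∀ a, Homog τ (c.par (Sum.inr a)) (z a)) :
    ∃ F : c.Fn V →ₐ[ℝ] C, (∀ s, F (c.ofBase V s) = β s) ∧
      ∀ a, F (c.coord V (Sum.inr a)) = z a := by
  obtain ⟨γ, hγ, hγ0⟩ := exists_even_lift hτ (fun y => z (Sum.inl y)) fun y => hz (Sum.inl y)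
  let l : (c.O →₀ ℝ) →ₗ[ℝ] C := Finsupp.linearCombination ℝ fun o => z (Sum.inr o)
  have hl : ∀ v, Homog τ 1 (l v) := fun v => by
    simp only [l, Finsupp.linearCombination_apply]
    exact Homog.sum _ fun o _ => (hz (Sum.inr o)).smul _
  have hl2 : ∀ v, l v * l v = 0 := fun v => by
    have := hτ.comm_homog (hl v) (hl v)
    rw [mul_one, pow_one, neg_one_smul] at this
    have h2 : (2 : ℝ) • (l v * l v) = 0 := by rw [two_smul]; exact add_eq_zero_iff_eq_neg.2 this
    exact (smul_eq_zero_iff_right two_ne_zero).1 h2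
  let δ := ExteriorAlgebra.lift ℝ ⟨l, hl2⟩
  have hcomm : ∀ u v, Homog τ 0 u → Commute u v := fun u v hu => hτ.comm 0 u v hu
  refine ⟨Algebra.TensorProduct.lift β (Algebra.TensorProduct.lift γ δ
    fun k e => hcomm _ _ (hγ0 k)) fun s u => hcomm _ _ (hβ s), fun s => ?_, ?_⟩
  · exact (Algebra.TensorProduct.lift_tmul _ _ _ s 1).trans (by rw [map_one, mul_one])
  · rintro (y | o)
    · refine (Algebra.TensorProduct.lift_tmul _ _ _ 1 _).trans ?_
      rw [map_one, one_mul, Algebra.TensorProduct.lift_tmul, map_one, mul_one, hγ]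
    · refine (Algebra.TensorProduct.lift_tmul _ _ _ 1 _).trans ?_
      rw [map_one, one_mul, Algebra.TensorProduct.lift_tmul, map_one, one_mul]
      simp [δ, l]

/-! ### Restriction of functions -/

lemma res_ofBase (h : V' ≤ V) (s : Smooth c.B V) :
    c.res h (c.ofBase V s) = c.ofBase V' (Smooth.res h s) := rfl

lemma res_coord (h : V' ≤ V) (a : c.Idx) : c.res h (c.coord V a) = c.coord V' a := by
  rcases a with a | a | a
  · rfl
  · rfl
  · rfl

lemma res_sgn (h : V' ≤ V) (f : c.Fn V) : c.res h (c.sgn V f) = c.sgn V' (c.res h f) := by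
  refine DFunLike.congr_fun (f := (c.res h).comp (c.sgn V)) (g := (c.sgn V').comp (c.res h))
    (algHom_ext (fun s => ?_) fun a => ?_) f
  · rw [AlgHom.comp_apply, AlgHom.comp_apply, homog_ofBase, map_smul, res_ofBase, homog_ofBase]
  · rw [AlgHom.comp_apply, AlgHom.comp_apply, homog_coord, map_smul, res_coord, homog_coord]

lemma res_pd (h : V' ≤ V) (a : c.Idx) (f : c.Fn V) :
    c.res h (c.pd V a f) = c.pd V' a (c.res h f) := by
  refine induction_tmul (p := fun f => c.res h (c.pd V a f) = c.pd V' a (c.res h f)) f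
    (fun s m e => ?_) (fun f g hf hg => by simp only [map_add, hf, hg]) (by simp only [map_zero])
  rcases a with a | a | a
  · change c.tmul V' (Smooth.res h (Smooth.pd V a s)) m e =
      c.tmul V' (Smooth.pd V' a (Smooth.res h s)) m e
    rw [Smooth.pd_res]
  · rfl
  · rfl

/-! ### Pullback to the cotangent bundle -/

variable (k : ℤ)

lemma pull_ofBase (s : Smooth c.B V) :
    c.pull V k (c.ofBase V s) = (c.cot k).ofBase V s := by
  change (c.cot k).tmul V s (MvPolynomial.rename Sum.inl 1) (ExteriorAlgebra.map _ 1) = _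
  rw [map_one, map_one]
  rfl

lemma pull_coord (a : c.Idx) : c.pull V k (c.coord V a) = (c.cot k).coord V (c.pos k a) := by
  rcases a with a | a | a
  · exact pull_ofBase k _
  · change (c.cot k).tmul V 1 (MvPolynomial.rename Sum.inl (MvPolynomial.X a))
      (ExteriorAlgebra.map _ 1) = _
    rw [MvPolynomial.rename_X, map_one]
    rfl
  · change (c.cot k).tmul V 1 (MvPolynomial.rename Sum.inl 1)
      (ExteriorAlgebra.map _ (ExteriorAlgebra.ι ℝ _)) = _
    rw [map_one, ExteriorAlgebra.map_apply_ι, Finsupp.lmapDomain_apply, Finsupp.mapDomain_single]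
    rfl

lemma par_pos (a : c.Idx) : (c.cot k).par (c.pos k a) = c.par a := by
  rcases a with a | a | a <;> rfl

lemma par_mom (a : c.Idx) : (c.cot k).par (c.mom k a) = c.par a := by
  rcases a with a | a | a <;> rfl

lemma pos_injective : Function.Injective (c.pos k) := by
  rintro (a | a | a) (b | b | b) h <;> simp_all [pos]

lemma mom_injective : Function.Injective (c.mom k) := by
  rintro (a | a | a) (b | b | b) h <;> simp_all [mom]

lemma pos_ne_mom (a b : c.Idx) : c.pos k a ≠ c.mom k b := by
  rcases a with a | a | a <;> rcases b with b | b | b <;> simp [pos, mom]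

lemma exists_pos_or_mom (z : (c.cot k).Idx) : (∃ a, z = c.pos k a) ∨ ∃ a, z = c.mom k a := by
  rcases z with b | (y | b | y) | (o | o)
  · exact Or.inl ⟨Sum.inl b, rfl⟩
  · exact Or.inl ⟨Sum.inr (Sum.inl y), rfl⟩
  · exact Or.inr ⟨Sum.inl b, rfl⟩
  · exact Or.inr ⟨Sum.inr (Sum.inl y), rfl⟩
  · exact Or.inl ⟨Sum.inr (Sum.inr o), rfl⟩
  · exact Or.inr ⟨Sum.inr (Sum.inr o), rfl⟩

lemma cot_sum {N : Type*} [AddCommMonoid N] (F : (c.cot k).Idx → N) :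
    ∑ z, F z = ∑ a, F (c.pos k a) + ∑ a, F (c.mom k a) := by
  simp only [Fintype.sum_sum_type, pos, mom]
  abel

lemma pull_sgn (f : c.Fn V) : c.pull V k (c.sgn V f) = (c.cot k).sgn V (c.pull V k f) := by
  refine DFunLike.congr_fun (f := (c.pull V k).comp (c.sgn V))
    (g := ((c.cot k).sgn V).comp (c.pull V k)) (algHom_ext (fun s => ?_) fun a => ?_) f
  · rw [AlgHom.comp_apply, AlgHom.comp_apply, homog_ofBase, map_smul, pull_ofBase, homog_ofBase]
  · rw [AlgHom.comp_apply, AlgHom.comp_apply, homog_coord, map_smul, pull_coord, homog_coord,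
      par_pos]

lemma homog_pull {n : ℕ} {f : c.Fn V} (hf : Homog (c.sgn V) n f) :
    Homog ((c.cot k).sgn V) n (c.pull V k f) := by
  rw [Homog, ← pull_sgn, hf, map_smul]

lemma pull_sgn_pow (n : ℕ) (f : c.Fn V) :
    c.pull V k ((c.sgn V ^ n) f) = ((c.cot k).sgn V ^ n) (c.pull V k f) := by
  induction n generalizing f with
  | zero => rfl
  | succ n ih => rw [pow_succ, pow_succ, AlgHom.mul_apply, AlgHom.mul_apply, ih, pull_sgn]

lemma homog_p (a : c.Idx) : Homog ((c.cot k).sgn V) (c.par a) (c.p V k a) := by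
  rw [← par_mom k a]
  exact homog_coord _

lemma sder_pd_pos (a : c.Idx) : SDer ((c.cot k).sgn V) (c.par a) ((c.cot k).pd V (c.pos k a)) := by
  rw [← par_pos k a]
  exact sder_pd _

lemma sder_pd_mom (a : c.Idx) : SDer ((c.cot k).sgn V) (c.par a) ((c.cot k).pd V (c.mom k a)) := by
  rw [← par_mom k a]
  exact sder_pd _

lemma pd_mom_pull (a : c.Idx) (f : c.Fn V) : (c.cot k).pd V (c.mom k a) (c.pull V k f) = 0 := by
  classical
  have hD := sder_pd_mom (V := V) k a
  let T : Subalgebra ℝ (c.Fn V) :=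
    { carrier := {f | (c.cot k).pd V (c.mom k a) (c.pull V k f) = 0}
      mul_mem' := by
        intro f g hf hg
        change (c.cot k).pd V (c.mom k a) (c.pull V k (f * g)) = 0
        rw [map_mul, hD.leibniz, show (c.cot k).pd V (c.mom k a) (c.pull V k f) = 0 from hf,
          show (c.cot k).pd V (c.mom k a) (c.pull V k g) = 0 from hg, zero_mul, mul_zero, zero_add]
      add_mem' := by
        intro f g hf hg
        change (c.cot k).pd V (c.mom k a) (c.pull V k (f + g)) = 0
        rw [map_add, map_add, show (c.cot k).pd V (c.mom k a) (c.pull V k f) = 0 from hf,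
          show (c.cot k).pd V (c.mom k a) (c.pull V k g) = 0 from hg, zero_add]
      algebraMap_mem' := by
        intro r
        change (c.cot k).pd V (c.mom k a) (c.pull V k (algebraMap ℝ _ r)) = 0
        rw [AlgHom.commutes, hD.map_algebraMap] }
  have hT : ∀ b, c.coord V b ∈ T := fun b => by
    change (c.cot k).pd V (c.mom k a) (c.pull V k (c.coord V b)) = 0
    rw [pull_coord, pd_coord, if_neg (pos_ne_mom k b a).symm]
  refine mem_of_generators T (fun s => ?_) (fun y => hT _) (fun o => hT _) f
  change (c.cot k).pd V (c.mom k a) (c.pull V k (c.ofBase V s)) = 0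
  rw [pull_ofBase]
  rcases a with a | a | a
  · exact pd_inr_ofBase (c := c.cot k) _ s
  · exact pd_inr_ofBase (c := c.cot k) _ s
  · exact pd_inr_ofBase (c := c.cot k) _ s

lemma pd_pos_pull (a : c.Idx) (f : c.Fn V) :
    (c.cot k).pd V (c.pos k a) (c.pull V k f) = c.pull V k (c.pd V a f) := by
  classical
  have hD := sder_pd_pos (V := V) k a
  have hE := sder_pd (V := V) a
  let T : Subalgebra ℝ (c.Fn V) :=
    { carrier := {f | (c.cot k).pd V (c.pos k a) (c.pull V k f) = c.pull V k (c.pd V a f)}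
      mul_mem' := by
        intro f g hf hg
        change (c.cot k).pd V (c.pos k a) (c.pull V k (f * g)) = c.pull V k (c.pd V a (f * g))
        rw [map_mul, hD.leibniz, hE.leibniz, map_add, map_mul, map_mul, pull_sgn_pow,
          show (c.cot k).pd V (c.pos k a) (c.pull V k f) = _ from hf,
          show (c.cot k).pd V (c.pos k a) (c.pull V k g) = _ from hg]
      add_mem' := by
        intro f g hf hg
        change (c.cot k).pd V (c.pos k a) (c.pull V k (f + g)) = c.pull V k (c.pd V a (f + g))
        rw [map_add, map_add, map_add, map_add,
          show (c.cot k).pd V (c.pos k a) (c.pull V k f) = _ from hf,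
          show (c.cot k).pd V (c.pos k a) (c.pull V k g) = _ from hg]
      algebraMap_mem' := by
        intro r
        change (c.cot k).pd V (c.pos k a) (c.pull V k (algebraMap ℝ _ r)) =
          c.pull V k (c.pd V a (algebraMap ℝ _ r))
        rw [AlgHom.commutes, hD.map_algebraMap, hE.map_algebraMap, map_zero] }
  have hT : ∀ b, c.coord V b ∈ T := fun b => by
    change (c.cot k).pd V (c.pos k a) (c.pull V k (c.coord V b)) =
      c.pull V k (c.pd V a (c.coord V b))
    rw [pull_coord, pd_coord, pd_coord]
    by_cases h : a = b
    · rw [if_pos h, if_pos (by rw [h]), map_one]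
    · rw [if_neg h, if_neg (fun h' => h (pos_injective k h')), map_zero]
  refine mem_of_generators T (fun s => ?_) (fun y => hT _) (fun o => hT _) f
  change (c.cot k).pd V (c.pos k a) (c.pull V k (c.ofBase V s)) =
    c.pull V k (c.pd V a (c.ofBase V s))
  rw [pull_ofBase]
  rcases a with a | a | a
  · rw [pd_B_ofBase, pull_ofBase]
    exact pd_B_ofBase (c := c.cot k) a s
  · rw [pd_inr_ofBase, map_zero]
    exact pd_inr_ofBase (c := c.cot k) _ s
  · rw [pd_inr_ofBase, map_zero]
    exact pd_inr_ofBase (c := c.cot k) _ s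

lemma res_pull (h : V' ≤ V) (f : c.Fn V) :
    (c.cot k).res h (c.pull V k f) = c.pull V' k (c.res h f) := by
  refine DFunLike.congr_fun (f := ((c.cot k).res h).comp (c.pull V k))
    (g := (c.pull V' k).comp (c.res h)) (algHom_ext (fun s => ?_) fun a => ?_) f
  · rw [AlgHom.comp_apply, AlgHom.comp_apply, pull_ofBase, res_ofBase, res_ofBase, pull_ofBase]
  · rw [AlgHom.comp_apply, AlgHom.comp_apply, pull_coord, res_coord, res_coord, pull_coord]

/-- The functions on the base and the momenta generate the functions on the cotangent bundle. -/
lemma cot_algHom_ext {C : Type*} [Ring C] [Algebra ℝ C] {F G : (c.cot k).Fn V →ₐ[ℝ] C}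
    (h : ∀ f, F (c.pull V k f) = G (c.pull V k f)) (hp : ∀ a, F (c.p V k a) = G (c.p V k a)) :
    F = G := by
  refine algHom_ext (fun s => ?_) fun a => ?_
  · have := h (c.ofBase V s)
    rwa [pull_ofBase] at this
  · obtain ⟨b, hb⟩ | ⟨b, hb⟩ := exists_pos_or_mom k (Sum.inr a)
    · rw [hb, ← pull_coord, h]
    · rw [hb]
      exact hp b

end Generation

end Coords

namespace Coords

section Poisson

variable {c : Coords} {V : Opens (c.B → ℝ)} {k : ℤ}

/-! ### The canonical Poisson bracket -/

/-- The defining formula of the bracket for a Hamiltonian of parity `n`, with explicit signs. -/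
lemma ham_apply {n : ℕ} {H : (c.cot k).Fn V} (hH : Homog ((c.cot k).sgn V) n H)
    (g : (c.cot k).Fn V) : c.ham V k H g = ∑ a,
      ((-1 : ℝ) ^ (c.par a * (n + 1)) •
          ((c.cot k).pd V (c.mom k a) H * (c.cot k).pd V (c.pos k a) g) -
        (-1 : ℝ) ^ (c.par a * n) •
          ((c.cot k).pd V (c.pos k a) H * (c.cot k).pd V (c.mom k a) g)) := by
  rw [ham, LinearMap.sum_apply]
  refine Finset.sum_congr rfl fun a _ => ?_
  rw [LinearMap.sub_apply, LinearMap.smul_apply, LinearMap.comp_apply, LinearMap.comp_apply,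
    LinearMap.mulLeft_apply, LinearMap.mulLeft_apply, hH.pow_apply, map_smul, map_smul,
    smul_mul_assoc, smul_mul_assoc, smul_smul, ← pow_add]
  congr 3
  ring

lemma sder_ham {n : ℕ} {H : (c.cot k).Fn V} (hH : Homog ((c.cot k).sgn V) n H) :
    SDer ((c.cot k).sgn V) n (c.ham V k H) := by
  have h : c.ham V k H = ∑ a,
      ((-1 : ℝ) ^ (c.par a * (n + 1)) • (LinearMap.mulLeft ℝ ((c.cot k).pd V (c.mom k a) H) ∘ₗ
          (c.cot k).pd V (c.pos k a)) -
        (-1 : ℝ) ^ (c.par a * n) • (LinearMap.mulLeft ℝ ((c.cot k).pd V (c.pos k a) H) ∘ₗ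
          (c.cot k).pd V (c.mom k a))) := by
    refine LinearMap.ext fun g => ?_
    rw [ham_apply hH, LinearMap.sum_apply]
    rfl
  rw [h]
  refine SDer.sum _ fun a _ => SDer.sub (SDer.smul _ (sder_mul_pd _ ?_))
    (SDer.smul _ (sder_mul_pd _ ?_))
  · rw [par_pos, add_comm]
    exact (sder_pd_mom k a).homog hH
  · rw [par_mom, add_comm]
    exact (sder_pd_pos k a).homog hH

lemma ham_add (F G : (c.cot k).Fn V) : c.ham V k (F + G) = c.ham V k F + c.ham V k G := by
  simp only [ham]
  rw [← Finset.sum_add_distrib]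
  refine Finset.sum_congr rfl fun a _ => LinearMap.ext fun g => ?_
  simp only [LinearMap.add_apply, LinearMap.sub_apply, LinearMap.smul_apply, LinearMap.comp_apply,
    LinearMap.mulLeft_apply, map_add, add_mul, smul_add]
  abel

lemma ham_smul (r : ℝ) (F : (c.cot k).Fn V) : c.ham V k (r • F) = r • c.ham V k F := by
  simp only [ham]
  rw [Finset.smul_sum]
  refine Finset.sum_congr rfl fun a _ => LinearMap.ext fun g => ?_
  simp only [LinearMap.sub_apply, LinearMap.smul_apply, LinearMap.comp_apply,
    LinearMap.mulLeft_apply, map_smul, smul_mul_assoc, smul_sub, smul_comm r]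

lemma ham_zero : c.ham V k 0 = 0 := by
  have := ham_smul (c := c) (V := V) (k := k) 0 0
  rwa [zero_smul, zero_smul] at this

lemma ham_pos {n : ℕ} {H : (c.cot k).Fn V} (hH : Homog ((c.cot k).sgn V) n H) (a : c.Idx) :
    c.ham V k H ((c.cot k).coord V (c.pos k a)) =
      (-1 : ℝ) ^ (c.par a * (n + 1)) • (c.cot k).pd V (c.mom k a) H := by
  classical
  rw [ham_apply hH, Finset.sum_eq_single a]
  · rw [pd_coord, pd_coord, if_pos rfl, if_neg (pos_ne_mom k a a).symm, mul_one, mul_zero,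
      smul_zero, sub_zero]
  · intro b _ hb
    rw [pd_coord, pd_coord, if_neg (fun h => hb (pos_injective k h)),
      if_neg (pos_ne_mom k a b).symm, mul_zero, mul_zero, smul_zero, smul_zero, sub_zero]
  · intro h
    exact absurd (Finset.mem_univ _) h

lemma ham_mom {n : ℕ} {H : (c.cot k).Fn V} (hH : Homog ((c.cot k).sgn V) n H) (a : c.Idx) :
    c.ham V k H ((c.cot k).coord V (c.mom k a)) =
      -((-1 : ℝ) ^ (c.par a * n) • (c.cot k).pd V (c.pos k a) H) := by
  classical
  rw [ham_apply hH, Finset.sum_eq_single a]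
  · rw [pd_coord, pd_coord, if_pos rfl, if_neg (pos_ne_mom k a a), mul_one, mul_zero,
      smul_zero, zero_sub]
  · intro b _ hb
    rw [pd_coord, pd_coord, if_neg (fun h => hb (mom_injective k h)),
      if_neg (pos_ne_mom k b a), mul_zero, mul_zero, smul_zero, smul_zero, sub_zero]
  · intro h
    exact absurd (Finset.mem_univ _) h

lemma ham_antisymm {m n : ℕ} {F G : (c.cot k).Fn V} (hF : Homog ((c.cot k).sgn V) m F)
    (hG : Homog ((c.cot k).sgn V) n G) :
    c.ham V k F G = -((-1 : ℝ) ^ (m * n) • c.ham V k G F) := by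
  rw [ham_apply hF, ham_apply hG, Finset.smul_sum, ← Finset.sum_neg_distrib]
  refine Finset.sum_congr rfl fun a _ => ?_
  rw [isSuperComm.comm_homog ((sder_pd_mom k a).homog hF) ((sder_pd_pos k a).homog hG),
    isSuperComm.comm_homog ((sder_pd_pos k a).homog hF) ((sder_pd_mom k a).homog hG),
    smul_sub, smul_smul, smul_smul, smul_smul, smul_smul, ← pow_add, ← pow_add, ← pow_add,
    ← pow_add, neg_sub]
  congr 2 <;>
  · apply neg_one_pow_congr
    simp only [Nat.even_add, Nat.even_mul, Nat.not_even_one]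
    tauto

/-- Partial derivatives are derivations of the Poisson bracket. -/
lemma pd_ham {n : ℕ} {F : (c.cot k).Fn V} (hF : Homog ((c.cot k).sgn V) n F)
    (z : (c.cot k).Idx) (G : (c.cot k).Fn V) :
    (c.cot k).pd V z (c.ham V k F G) = c.ham V k ((c.cot k).pd V z F) G +
      (-1 : ℝ) ^ ((c.cot k).par z * n) • c.ham V k F ((c.cot k).pd V z G) := by
  classical
  have hzF := (sder_pd z).homog hF
  have h : superComm ((c.cot k).par z) n ((c.cot k).pd V z) (c.ham V k F) =
      c.ham V k ((c.cot k).pd V z F) := by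
    refine sder_ext ((sder_pd z).superComm (sder_ham hF))
      ((sder_ham hzF).congr isSuperComm (by rw [add_comm])) fun y => ?_
    rw [superComm_apply, pd_coord, map_one_or_zero (sder_ham hF), smul_zero, sub_zero]
    obtain ⟨a, rfl⟩ | ⟨a, rfl⟩ := exists_pos_or_mom k y
    · rw [ham_pos hF, ham_pos hzF, map_smul, pd_pd, smul_smul, par_mom, ← pow_add]
      congr 1
      apply neg_one_pow_congr
      simp only [Nat.even_add, Nat.even_mul, Nat.not_even_one]
      tauto
    · rw [ham_mom hF, ham_mom hzF, map_neg, map_smul, pd_pd, smul_smul, par_pos, ← pow_add]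
      congr 2
      apply neg_one_pow_congr
      simp only [Nat.even_add, Nat.even_mul]
      tauto
  have h1 := LinearMap.congr_fun h G
  rw [superComm_apply, sub_eq_iff_eq_add] at h1
  exact h1

/-- The Jacobi identity for the canonical Poisson bracket. -/
lemma superComm_ham {m n : ℕ} {F G : (c.cot k).Fn V} (hF : Homog ((c.cot k).sgn V) m F)
    (hG : Homog ((c.cot k).sgn V) n G) :
    superComm m n (c.ham V k F) (c.ham V k G) = c.ham V k (c.ham V k F G) := by
  have hFG := (sder_ham hF).homog hG
  refine sder_ext ((sder_ham hF).superComm (sder_ham hG))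
    ((sder_ham hFG).congr isSuperComm (by rw [add_comm])) fun y => ?_
  rw [superComm_apply]
  obtain ⟨a, rfl⟩ | ⟨a, rfl⟩ := exists_pos_or_mom k y
  · rw [ham_pos hF, ham_pos hG, ham_pos hFG, pd_ham hF,
      ham_antisymm ((sder_pd_mom k a).homog hF) hG, map_smul, map_smul, smul_smul, par_mom,
      smul_add, smul_neg, smul_smul, smul_smul, ← pow_add, ← pow_add, ← pow_add,
      sub_eq_neg_add]
    refine congrArg₂ _ (congrArg _ (congrArg₂ _ ?_ rfl)) (congrArg₂ _ ?_ rfl) <;>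
    · apply neg_one_pow_congr
      simp only [Nat.even_add, Nat.even_mul, Nat.not_even_one]
      tauto
  · rw [ham_mom hF, ham_mom hG, ham_mom hFG, pd_ham hF,
      ham_antisymm ((sder_pd_pos k a).homog hF) hG, map_neg, map_neg, map_smul, map_smul,
      par_pos, smul_add, smul_neg, smul_neg, smul_smul, smul_smul, smul_smul, ← pow_add, ← pow_add,
      ← pow_add, neg_add, sub_neg_eq_add, neg_neg, add_comm]
    congr 2
    · apply neg_one_pow_congr
      simp only [Nat.even_add, Nat.even_mul]
      tauto
    · congr 1
      apply neg_one_pow_congr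
      simp only [Nat.even_add, Nat.even_mul]
      tauto

lemma ham_ham {m n : ℕ} {F G : (c.cot k).Fn V} (hF : Homog ((c.cot k).sgn V) m F)
    (hG : Homog ((c.cot k).sgn V) n G) (f : (c.cot k).Fn V) :
    c.ham V k (c.ham V k F G) f = c.ham V k F (c.ham V k G f) -
      (-1 : ℝ) ^ (m * n) • c.ham V k G (c.ham V k F f) := by
  rw [← superComm_ham hF hG, superComm_apply]

/-- If position and momentum weights add up to the constant `κ`, the Poisson bracket has
weight `-κ`. -/
lemma eulerOf_ham {ν : (c.cot k).Idx → ℝ} {κ : ℝ} (hν : ∀ a, ν (c.pos k a) + ν (c.mom k a) = κ)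
    {n : ℕ} {F : (c.cot k).Fn V} (hF : Homog ((c.cot k).sgn V) n F) {v w : ℝ}
    (hFv : (c.cot k).eulerOf V ν F = v • F) {g : (c.cot k).Fn V}
    (hg : (c.cot k).eulerOf V ν g = w • g) :
    (c.cot k).eulerOf V ν (c.ham V k F g) = (v + w - κ) • c.ham V k F g := by
  have h : superComm 0 n ((c.cot k).eulerOf V ν) (c.ham V k F) = (v - κ) • c.ham V k F := by
    refine sder_ext ((sder_eulerOf ν).superComm (sder_ham hF))
      (((sder_ham hF).smul _).congr isSuperComm (by rw [zero_add])) fun y => ?_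
    rw [superComm_apply, eulerOf_coord, LinearMap.smul_apply, zero_mul, pow_zero, one_smul,
      map_smul]
    obtain ⟨a, rfl⟩ | ⟨a, rfl⟩ := exists_pos_or_mom k y
    · rw [ham_pos hF, map_smul, eulerOf_pd ν hFv, smul_comm _ (_ - _), ← sub_smul, ← hν a]
      congr 1
      ring
    · rw [ham_mom hF, map_neg, map_smul, eulerOf_pd ν hFv, smul_comm _ (_ - _), smul_neg, smul_neg,
        sub_neg_eq_add, ← neg_smul, ← add_smul, ← neg_smul, ← hν a]
      congr 1
      ring
  have h1 := LinearMap.congr_fun h g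
  rw [superComm_apply, hg, map_smul, zero_mul, pow_zero, one_smul, LinearMap.smul_apply,
    sub_eq_iff_eq_add, ← add_smul] at h1
  rw [h1]
  congr 1
  ring

lemma eulerOf_pull (ν : (c.cot k).Idx → ℝ) (f : c.Fn V) : (c.cot k).eulerOf V ν (c.pull V k f) =
    c.pull V k (c.eulerOf V (fun a => ν (c.pos k a)) f) := by
  rw [eulerOf_apply, eulerOf_apply, cot_sum, map_sum]
  rw [Finset.sum_eq_zero (s := Finset.univ) (f := fun a => ν (c.mom k a) • _), add_zero]
  · refine Finset.sum_congr rfl fun a _ => ?_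
    rw [pd_pos_pull, map_smul, map_mul, pull_coord]
  · intro a _
    rw [pd_mom_pull, mul_zero, smul_zero]

/-! ### The fibrewise degree -/

/-- The degrees of the cotangent coordinates in the momenta. -/
def momDeg (c : Coords) (k : ℤ) : (c.cot k).Idx → ℝ :=
  Sum.elim (fun _ => 0) (Sum.elim (Sum.elim (fun _ => 0) fun _ => 1)
    (Sum.elim (fun _ => 0) fun _ => 1))

lemma momDeg_pos (a : c.Idx) : c.momDeg k (c.pos k a) = 0 := by
  rcases a with a | a | a <;> rfl

lemma momDeg_mom (a : c.Idx) : c.momDeg k (c.mom k a) = 1 := by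
  rcases a with a | a | a <;> rfl

/-- The function is homogeneous of degree `r` in the momenta. -/
def HasDeg (r : ℝ) (F : (c.cot k).Fn V) : Prop := (c.cot k).eulerOf V (c.momDeg k) F = r • F

lemma hasDeg_pull (f : c.Fn V) : HasDeg (k := k) 0 (c.pull V k f) := by
  rw [HasDeg, eulerOf_pull, zero_smul, eulerOf_apply]
  simp only [momDeg_pos, zero_smul, Finset.sum_const_zero, map_zero]

lemma hasDeg_p (a : c.Idx) : HasDeg 1 (c.p V k a) := by
  rw [HasDeg, p, eulerOf_coord, momDeg_mom]

namespace HasDeg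

variable {r r' : ℝ} {F G : (c.cot k).Fn V}

lemma mul (hF : HasDeg r F) (hG : HasDeg r' G) : HasDeg (r + r') (F * G) := eulerOf_mul _ hF hG

lemma sum {ι : Type*} (s : Finset ι) {F : ι → (c.cot k).Fn V} (h : ∀ i ∈ s, HasDeg r (F i)) :
    HasDeg r (∑ i ∈ s, F i) := by
  rw [HasDeg, map_sum, Finset.smul_sum]
  exact Finset.sum_congr rfl h

lemma smul (t : ℝ) (hF : HasDeg r F) : HasDeg r (t • F) := by
  rw [HasDeg, map_smul, hF, smul_comm]

lemma ham {n : ℕ} (hn : Homog ((c.cot k).sgn V) n F) (hF : HasDeg r F) (hG : HasDeg r' G) :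
    HasDeg (r + r' - 1) (c.ham V k F G) :=
  eulerOf_ham (fun a => by rw [momDeg_pos, momDeg_mom, zero_add]) hn hF hG

end HasDeg

/-- A function of nonzero degree in the momenta is determined by its Poisson brackets with the
coordinates of the base, since these are its derivatives along the momenta. -/
lemma eq_zero_of_ham_pos {n : ℕ} {T : (c.cot k).Fn V} (hn : Homog ((c.cot k).sgn V) n T) {r : ℝ}
    (hr : r ≠ 0) (hT : HasDeg r T)
    (h : ∀ a, c.ham V k T (c.pull V k (c.coord V a)) = 0) : T = 0 := by
  have h1 : ∀ a, (c.cot k).pd V (c.mom k a) T = 0 := fun a => by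
    have := h a
    rw [pull_coord, ham_pos hn] at this
    exact (smul_eq_zero_iff_right (pow_ne_zero _ (by norm_num))).1 this
  have h2 : r • T = 0 := by
    rw [← show (c.cot k).eulerOf V (c.momDeg k) T = r • T from hT, eulerOf_apply, cot_sum]
    simp only [momDeg_pos, zero_smul, Finset.sum_const_zero, h1, mul_zero, smul_zero, add_zero]
  exact (smul_eq_zero_iff_right hr).1 h2

lemma eq_of_ham_pos {n : ℕ} {F G : (c.cot k).Fn V} (hF : Homog ((c.cot k).sgn V) n F)
    (hG : Homog ((c.cot k).sgn V) n G) {r : ℝ} (hr : r ≠ 0) (hF' : HasDeg r F) (hG' : HasDeg r G)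
    (h : ∀ a, c.ham V k F (c.pull V k (c.coord V a)) = c.ham V k G (c.pull V k (c.coord V a))) :
    F = G := by
  rw [← sub_eq_zero]
  refine eq_zero_of_ham_pos (hF.sub hG) hr ?_ fun a => ?_
  · rw [HasDeg, map_sub, hF', hG', smul_sub]
  · rw [sub_eq_add_neg, ← neg_one_smul ℝ G, ham_add, ham_smul, LinearMap.add_apply,
      LinearMap.smul_apply, h, neg_one_smul, add_neg_cancel]

/-! ### Hamiltonians of vector fields -/

lemma ham_pull_pull {n : ℕ} {f : c.Fn V} (hf : Homog (c.sgn V) n f) (g : c.Fn V) :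
    c.ham V k (c.pull V k f) (c.pull V k g) = 0 := by
  rw [ham_apply (homog_pull k hf)]
  simp only [pd_mom_pull, zero_mul, mul_zero, smul_zero, sub_zero, Finset.sum_const_zero]

lemma fieldHam_zero : c.fieldHam k (0 : c.Fn V →ₗ[ℝ] c.Fn V) = 0 := by
  rw [fieldHam]
  exact Finset.sum_eq_zero fun a _ => by rw [LinearMap.zero_apply, map_zero, zero_mul]

lemma hasDeg_fieldHam (D : c.Fn V →ₗ[ℝ] c.Fn V) : HasDeg 1 (c.fieldHam k D) := by
  refine HasDeg.sum _ fun a _ => ?_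
  have := (hasDeg_pull (k := k) (D (c.coord V a))).mul (hasDeg_p a)
  rwa [zero_add] at this

variable {m n : ℕ} {D E : c.Fn V →ₗ[ℝ] c.Fn V}

lemma homog_fieldHam (hD : SDer (c.sgn V) m D) :
    Homog ((c.cot k).sgn V) m (c.fieldHam k D) := by
  refine Homog.sum _ fun a _ => ?_
  refine ((homog_pull k (hD.homog (homog_coord a))).mul (homog_p k a)).congr ?_
  apply neg_one_pow_congr
  simp only [Nat.even_add]
  tauto

lemma pd_mom_mul_p {u : c.Fn V} (hu : Homog (c.sgn V) n u) (F : (c.cot k).Fn V) (a : c.Idx) :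
    (c.cot k).pd V (c.mom k a) (c.pull V k u * F) =
      (-1 : ℝ) ^ (c.par a * n) • (c.pull V k u * (c.cot k).pd V (c.mom k a) F) := by
  rw [(sder_pd_mom k a).leibniz_homog (homog_pull k hu), pd_mom_pull, zero_mul, zero_add]

open Classical in
lemma pd_mom_p (a b : c.Idx) :
    (c.cot k).pd V (c.mom k a) (c.p V k b) = if a = b then 1 else 0 := by
  rw [p, pd_coord]
  by_cases h : a = b
  · rw [if_pos h, if_pos (by rw [h])]
  · rw [if_neg h, if_neg (fun h' => h (mom_injective k h'))]

/-- The Hamiltonian vector field of `p_D` extends `D`. -/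
lemma ham_fieldHam_pull (hD : SDer (c.sgn V) m D) (f : c.Fn V) :
    c.ham V k (c.fieldHam k D) (c.pull V k f) = c.pull V k (D f) := by
  classical
  rw [ham_apply (homog_fieldHam hD), sder_apply hD f, map_sum]
  refine Finset.sum_congr rfl fun a _ => ?_
  have h : (c.cot k).pd V (c.mom k a) (c.fieldHam k D) =
      (-1 : ℝ) ^ (c.par a * (c.par a + m)) • c.pull V k (D (c.coord V a)) := by
    rw [fieldHam, map_sum, Finset.sum_eq_single a]
    · rw [pd_mom_mul_p (hD.homog (homog_coord a)), pd_mom_p, if_pos rfl, mul_one]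
    · intro b _ hb
      rw [pd_mom_mul_p (hD.homog (homog_coord b)), pd_mom_p, if_neg hb.symm, mul_zero, smul_zero]
    · intro h
      exact absurd (Finset.mem_univ _) h
  rw [h, pd_pos_pull, pd_mom_pull, mul_zero, smul_zero, sub_zero, smul_mul_assoc, smul_smul,
    ← pow_add, map_mul, Even.neg_one_pow, one_smul]
  simp only [Nat.even_add, Nat.even_mul, Nat.not_even_one]
  tauto

/-- The bracket of the Hamiltonians of two vector fields is the Hamiltonian of their commutator. -/
lemma ham_fieldHam_fieldHam (hD : SDer (c.sgn V) m D) (hE : SDer (c.sgn V) n E) :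
    c.ham V k (c.fieldHam k D) (c.fieldHam k E) = c.fieldHam k (superComm m n D E) := by
  have hpD := homog_fieldHam (k := k) hD
  have hpE := homog_fieldHam (k := k) hE
  have hDE := hD.superComm hE
  refine eq_of_ham_pos (n := m + n) ?_ (homog_fieldHam hDE) one_ne_zero ?_
    (hasDeg_fieldHam _) fun a => ?_
  · rw [add_comm]
    exact (sder_ham hpD).homog hpE
  · have := (hasDeg_fieldHam (k := k) D).ham hpD (hasDeg_fieldHam E)
    rwa [add_sub_cancel_right] at this
  · rw [ham_ham hpD hpE, ham_fieldHam_pull hD, ham_fieldHam_pull hE, ham_fieldHam_pull hD,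
      ham_fieldHam_pull hE, ham_fieldHam_pull hDE, superComm_apply, map_sub, map_smul]

end Poisson

end Coords

/-! ### Schouten brackets and the homological Hamiltonian -/

/-- A Schouten (odd Poisson) bracket on a superalgebra. -/
structure IsOddPoisson {A : Type*} [Ring A] [Algebra ℝ A] (σ : A →ₐ[ℝ] A)
    (S : A →ₗ[ℝ] A →ₗ[ℝ] A) : Prop where
  map_par : ∀ (m n : ℕ) (f g : A), Homog σ m f → Homog σ n g → Homog σ (m + n + 1) (S f g)
  antisymm : ∀ (m n : ℕ) (f g : A), Homog σ m f → Homog σ n g →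
    S f g = -((-1 : ℝ) ^ ((m + 1) * (n + 1)) • S g f)
  jacobi : ∀ (m n : ℕ) (f g h : A), Homog σ m f → Homog σ n g →
    S f (S g h) = S (S f g) h + (-1 : ℝ) ^ ((m + 1) * (n + 1)) • S g (S f h)
  leibniz : ∀ (m n : ℕ) (f g h : A), Homog σ m f → Homog σ n g →
    S f (g * h) = S f g * h + (-1 : ℝ) ^ ((m + 1) * n) • (g * S f h)

namespace IsOddPoisson

variable {A : Type*} [Ring A] [Algebra ℝ A] {σ : A →ₐ[ℝ] A} {S : A →ₗ[ℝ] A →ₗ[ℝ] A}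

lemma sder (hS : IsOddPoisson σ S) (hσ : IsSuperComm σ) {m : ℕ} {f : A} (hf : Homog σ m f) :
    SDer σ (m + 1) (S f) :=
  SDer.of_homog hσ (fun n g hg => (hS.map_par m n f g hf hg).congr (by congr 1; ring))
    fun n g h hg => hS.leibniz m n f g h hf hg

lemma superComm_eq (hS : IsOddPoisson σ S) {m n : ℕ} {f g : A} (hf : Homog σ m f)
    (hg : Homog σ n g) : superComm (m + 1) (n + 1) (S f) (S g) = S (S f g) := by
  refine LinearMap.ext fun h => ?_
  rw [superComm_apply, hS.jacobi m n f g h hf hg, add_sub_cancel_right]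

end IsOddPoisson

namespace Coords

section Schouten

variable {c : Coords} {V : Opens (c.B → ℝ)} {k : ℤ} {S : c.Fn V →ₗ[ℝ] c.Fn V →ₗ[ℝ] c.Fn V}

lemma homog_schoutenTensor (hS : IsOddPoisson (c.sgn V) S) (a b : c.Idx) :
    Homog (c.sgn V) (c.par a + c.par b + 1)
      (-((-1 : ℝ) ^ c.par a • S (c.coord V a) (c.coord V b))) :=
  ((hS.map_par _ _ _ _ (homog_coord a) (homog_coord b)).smul _).neg

lemma homog_bracketHam (hS : IsOddPoisson (c.sgn V) S) :
    Homog ((c.cot k).sgn V) 1 (c.bracketHam k S) := by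
  refine Homog.smul _ (Homog.sum _ fun a _ => Homog.sum _ fun b _ => ?_)
  refine (((homog_pull k (homog_schoutenTensor hS a b)).mul (homog_p k b)).mul
    (homog_p k a)).congr ?_
  apply neg_one_pow_congr
  simp only [Nat.even_add]
  tauto

lemma hasDeg_bracketHam : HasDeg 2 (c.bracketHam k S) := by
  refine HasDeg.smul _ (HasDeg.sum _ fun a _ => HasDeg.sum _ fun b _ => ?_)
  have := ((hasDeg_pull (k := k) (-((-1 : ℝ) ^ c.par a • S (c.coord V a) (c.coord V b)))).mul
    (hasDeg_p b)).mul (hasDeg_p a)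
  norm_num at this ⊢
  exact this

/-- The two terms of the Leibniz rule contribute equally, because the Schouten tensor has the
symmetry of the product `p_b p_a`. -/
lemma ham_bracketHam_coord (hS : IsOddPoisson (c.sgn V) S) (d : c.Idx) :
    c.ham V k (c.bracketHam k S) (c.pull V k (c.coord V d)) =
      -((-1 : ℝ) ^ c.par d • c.fieldHam k (S (c.coord V d))) := by
  classical
  rw [pull_coord, ham_pos (homog_bracketHam hS), Even.neg_one_pow (by simp), one_smul]
  set u : c.Idx → c.Idx → c.Fn V := fun a b =>
    -((-1 : ℝ) ^ c.par a • S (c.coord V a) (c.coord V b)) with hu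
  have hterm : ∀ a b, (c.cot k).pd V (c.mom k d) (c.pull V k (u a b) * c.p V k b * c.p V k a) =
      (if d = b then (-1 : ℝ) ^ (c.par d * (c.par a + c.par b + 1)) •
        (c.pull V k (u a b) * c.p V k a) else 0) +
      (if d = a then (-1 : ℝ) ^ (c.par d * (c.par a + c.par b + 1) + c.par d * c.par b) •
        (c.pull V k (u a b) * c.p V k b) else 0) := by
    intro a b
    rw [mul_assoc, pd_mom_mul_p (homog_schoutenTensor hS a b),
      (sder_pd_mom k d).leibniz_homog (homog_p k b), pd_mom_p, pd_mom_p, mul_add (c.pull V k _), smul_add]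
    congr 1
    · split_ifs
      · rw [one_mul]
      · rw [zero_mul, mul_zero, smul_zero]
    · split_ifs
      · rw [mul_one, mul_smul_comm, smul_smul, ← pow_add]
      · rw [mul_zero, smul_zero, mul_zero, smul_zero]
  have h1 : ∀ a, (-1 : ℝ) ^ (c.par d * (c.par a + c.par d + 1)) •
      (c.pull V k (u a d) * c.p V k a) =
      -((-1 : ℝ) ^ c.par d • (c.pull V k (S (c.coord V d) (c.coord V a)) * c.p V k a)) := by
    intro a
    rw [hu]
    simp only
    rw [hS.antisymm _ _ _ _ (homog_coord a) (homog_coord d), smul_neg, neg_neg, smul_smul,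
      map_smul, smul_mul_assoc, smul_smul, ← neg_smul, ← pow_add, ← pow_add,
      ← neg_one_mul ((-1 : ℝ) ^ _), ← pow_succ']
    congr 1
    apply neg_one_pow_congr
    simp only [Nat.even_add, Nat.even_mul, Nat.not_even_one]
    tauto
  have h2 : ∀ b, (-1 : ℝ) ^ (c.par d * (c.par d + c.par b + 1) + c.par d * c.par b) •
      (c.pull V k (u d b) * c.p V k b) =
      -((-1 : ℝ) ^ c.par d • (c.pull V k (S (c.coord V d) (c.coord V b)) * c.p V k b)) := by
    intro b
    rw [hu]
    simp only
    rw [map_neg, map_smul, neg_mul, smul_neg, smul_mul_assoc, smul_smul, ← pow_add]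
    congr 2
    apply neg_one_pow_congr
    simp only [Nat.even_add, Nat.even_mul, Nat.not_even_one]
    tauto
  have h3 : ∀ a b, (c.cot k).pd V (c.mom k d) (c.pull V k (u a b) * c.p V k b * c.p V k a) =
      (if d = b then -((-1 : ℝ) ^ c.par d •
        (c.pull V k (S (c.coord V d) (c.coord V a)) * c.p V k a)) else 0) +
      (if d = a then -((-1 : ℝ) ^ c.par d •
        (c.pull V k (S (c.coord V d) (c.coord V b)) * c.p V k b)) else 0) := by
    intro a b
    rw [hterm]
    congr 1
    · by_cases h : d = b
      · subst h; rw [if_pos rfl, if_pos rfl, h1]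
      · rw [if_neg h, if_neg h]
    · by_cases h : d = a
      · subst h; rw [if_pos rfl, if_pos rfl, h2]
      · rw [if_neg h, if_neg h]
  rw [bracketHam, map_smul, map_sum]
  simp only [map_sum]
  rw [Finset.sum_congr rfl fun a _ => Finset.sum_congr rfl fun b _ => h3 a b]
  simp only [Finset.sum_add_distrib, Finset.sum_ite_eq, Finset.mem_univ, if_true]
  rw [Finset.sum_comm (f := fun a b => if d = a then _ else _)]
  simp only [Finset.sum_ite_eq, Finset.mem_univ, if_true]
  rw [← two_smul ℝ, smul_smul, Finset.sum_neg_distrib, ← Finset.smul_sum, fieldHam]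
  norm_num

/-- The Hamiltonian vector field of the bracket sends a function on the base to the Hamiltonian of
its Schouten-Hamiltonian vector field: the Schouten bracket is the derived bracket. -/
lemma ham_bracketHam_pull (hS : IsOddPoisson (c.sgn V) S) {m : ℕ} {f : c.Fn V}
    (hf : Homog (c.sgn V) m f) :
    c.ham V k (c.bracketHam k S) (c.pull V k f) = -((-1 : ℝ) ^ m • c.fieldHam k (S f)) := by
  have hH := homog_bracketHam (k := k) hS
  have hpf := homog_pull k hf
  have hSf := hS.sder isSuperComm hf
  refine eq_of_ham_pos (n := m + 1) ((sder_ham hH).homog hpf)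
    ((homog_fieldHam hSf).smul _).neg one_ne_zero ?_ ?_ fun b => ?_
  · have := (hasDeg_bracketHam (k := k) (S := S)).ham hH (hasDeg_pull f)
    norm_num at this
    exact this
  · rw [← neg_smul]
    exact (hasDeg_fieldHam _).smul _
  have hSb := hS.sder isSuperComm (homog_coord (V := V) b)
  rw [ham_ham hH hpf, ham_pull_pull hf, map_zero, zero_sub, ham_bracketHam_coord hS, map_neg,
    map_smul, ham_antisymm hpf (homog_fieldHam hSb), ham_fieldHam_pull hSb,
    hS.antisymm _ _ _ _ (homog_coord b) hf, ← neg_smul ((-1 : ℝ) ^ m), ham_smul,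
    LinearMap.smul_apply, ham_fieldHam_pull hSf]
  simp only [map_neg, map_smul, smul_neg, neg_neg, smul_smul, neg_smul, ← pow_add]
  rw [← neg_smul, ← neg_one_mul ((-1 : ℝ) ^ m), ← pow_succ']
  congr 1
  apply neg_one_pow_congr
  simp only [Nat.even_add, Nat.even_mul, Nat.not_even_one]
  tauto

/-- The Hamiltonian `S` commutes with those of the fields `S_f = {f, ·}_S`, because
`[S_f, S_g] = S_{{f, g}_S}`. -/
lemma ham_bracketHam_fieldHam_schouten (hS : IsOddPoisson (c.sgn V) S) {m : ℕ} {f : c.Fn V}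
    (hf : Homog (c.sgn V) m f) : c.ham V k (c.bracketHam k S) (c.fieldHam k (S f)) = 0 := by
  have hH := homog_bracketHam (k := k) hS
  have hSf := hS.sder isSuperComm hf
  have hpSf := homog_fieldHam (k := k) hSf
  refine eq_zero_of_ham_pos ((sder_ham hH).homog hpSf) two_ne_zero ?_ fun b => ?_
  · have := (hasDeg_bracketHam (k := k) (S := S)).ham hH (hasDeg_fieldHam (S f))
    norm_num at this
    exact this
  have hb := homog_coord (V := V) b
  rw [ham_ham hH hpSf, ham_fieldHam_pull hSf,
    ham_bracketHam_pull hS (hS.map_par _ _ _ _ hf hb), ham_bracketHam_pull hS hb, map_neg,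
    map_smul, ham_fieldHam_fieldHam hSf (hS.sder isSuperComm hb), hS.superComm_eq hf hb, smul_neg,
    sub_neg_eq_add, smul_smul, ← pow_add, neg_add_eq_zero]
  congr 1
  apply neg_one_pow_congr
  simp only [Nat.even_add, Nat.even_mul, Nat.not_even_one]
  tauto

/-- The master equation `{S, S} = 0`, a form of the Jacobi identity of the Schouten bracket. -/
lemma ham_bracketHam_self (hS : IsOddPoisson (c.sgn V) S) :
    c.ham V k (c.bracketHam k S) (c.bracketHam k S) = 0 := by
  have hH := homog_bracketHam (k := k) hS
  refine eq_zero_of_ham_pos ((sder_ham hH).homog hH) three_ne_zero ?_ fun b => ?_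
  · have := (hasDeg_bracketHam (k := k) (S := S)).ham hH (hasDeg_bracketHam (S := S))
    norm_num at this
    exact this
  have hb := homog_coord (V := V) b
  rw [ham_ham hH hH, ham_bracketHam_pull hS hb, map_neg, map_smul,
    ham_bracketHam_fieldHam_schouten hS hb, smul_zero, neg_zero, smul_zero, sub_zero]

variable {Q : c.Fn V →ₗ[ℝ] c.Fn V}

/-- The equation `{p_Q, p_Q} = 0` expresses `Q^2 = 0`. -/
lemma ham_fieldHam_self (hQ : SDer (c.sgn V) 1 Q) (hQ2 : ∀ f, Q (Q f) = 0) :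
    c.ham V k (c.fieldHam k Q) (c.fieldHam k Q) = 0 := by
  rw [ham_fieldHam_fieldHam hQ hQ]
  have : superComm 1 1 Q Q = 0 := LinearMap.ext fun f => by
    rw [superComm_apply, hQ2, smul_zero, sub_zero, LinearMap.zero_apply]
  rw [this, fieldHam_zero]

/-- The equation `{p_Q, S} = 0` expresses that `Q` is a derivation of the Schouten bracket, that is,
`[Q, S_f] = S_{Q f}`. -/
lemma ham_fieldHam_bracketHam (hQ : SDer (c.sgn V) 1 Q) (hS : IsOddPoisson (c.sgn V) S)
    (hQS : ∀ n f g, Homog (c.sgn V) n f →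
      Q (S f g) = S (Q f) g + (-1 : ℝ) ^ (n + 1) • S f (Q g)) :
    c.ham V k (c.fieldHam k Q) (c.bracketHam k S) = 0 := by
  have hH := homog_bracketHam (k := k) hS
  have hpQ := homog_fieldHam (k := k) hQ
  refine eq_zero_of_ham_pos ((sder_ham hpQ).homog hH) two_ne_zero ?_ fun b => ?_
  · have := (hasDeg_fieldHam (k := k) Q).ham hpQ (hasDeg_bracketHam (S := S))
    norm_num at this
    exact this
  have hb := homog_coord (V := V) b
  have h : superComm 1 (c.par b + 1) Q (S (c.coord V b)) = S (Q (c.coord V b)) :=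
    LinearMap.ext fun g => by
      rw [superComm_apply, hQS _ _ g hb, one_mul, add_sub_cancel_right]
  rw [ham_ham hpQ hH, ham_fieldHam_pull hQ, ham_bracketHam_pull hS hb,
    ham_bracketHam_pull hS (hQ.homog hb), map_neg, map_smul,
    ham_fieldHam_fieldHam hQ (hS.sder isSuperComm hb), h]
  simp only [pow_succ, pow_zero, mul_one, neg_smul, one_smul, mul_neg, neg_neg,
    sub_neg_eq_add, neg_add_cancel]

/-- The Hamiltonian of the vector field of the double. -/
def doubleHam (k : ℤ) (Q : c.Fn V →ₗ[ℝ] c.Fn V) (S : c.Fn V →ₗ[ℝ] c.Fn V →ₗ[ℝ] c.Fn V) (l : ℝ) :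
    (c.cot k).Fn V :=
  c.fieldHam k Q + l • c.bracketHam k S

lemma ham_doubleHam (l : ℝ) : c.ham V k (c.doubleHam k Q S l) =
    c.ham V k (c.fieldHam k Q) + l • c.ham V k (c.bracketHam k S) := by
  rw [doubleHam, ham_add, ham_smul]

lemma homog_doubleHam (hQ : SDer (c.sgn V) 1 Q) (hS : IsOddPoisson (c.sgn V) S) (l : ℝ) :
    Homog ((c.cot k).sgn V) 1 (c.doubleHam k Q S l) :=
  (homog_fieldHam hQ).add ((homog_bracketHam hS).smul l)

/-- The square of the field is half the Hamiltonian vector field of the bracket of the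
Hamiltonian with itself, which vanishes. -/
lemma ham_doubleHam_sq (hQ : SDer (c.sgn V) 1 Q) (hQ2 : ∀ f, Q (Q f) = 0)
    (hS : IsOddPoisson (c.sgn V) S)
    (hQS : ∀ n f g, Homog (c.sgn V) n f →
      Q (S f g) = S (Q f) g + (-1 : ℝ) ^ (n + 1) • S f (Q g)) (l : ℝ) (f : (c.cot k).Fn V) :
    c.ham V k (c.doubleHam k Q S l) (c.ham V k (c.doubleHam k Q S l) f) = 0 := by
  have hH := homog_doubleHam (k := k) hQ hS l
  have h0 : c.ham V k (c.doubleHam k Q S l) (c.doubleHam k Q S l) = 0 := by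
    have h1 := ham_fieldHam_bracketHam (k := k) hQ hS hQS
    have h2 : c.ham V k (c.bracketHam k S) (c.fieldHam k Q) = 0 := by
      rw [ham_antisymm (homog_bracketHam hS) (homog_fieldHam hQ), h1, smul_zero, neg_zero]
    rw [ham_doubleHam, doubleHam, LinearMap.add_apply, LinearMap.smul_apply, map_add, map_add,
      map_smul, map_smul, ham_fieldHam_self hQ hQ2, h1, h2, ham_bracketHam_self hS]
    simp only [smul_zero, add_zero]
  have h3 := ham_ham hH hH f
  rw [h0, ham_zero, LinearMap.zero_apply, mul_one, pow_one, neg_one_smul, sub_neg_eq_add,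
    ← two_smul ℝ] at h3
  exact (smul_eq_zero_iff_right two_ne_zero).1 h3.symm

/-! ### Weights on the cotangent bundle -/

lemma cot_wt_pos (a : c.Idx) : (c.cot k).wt (c.pos k a) = c.wt a := by
  rcases a with a | a | a
  · rfl
  · exact (by ring : c.wY a + k * 0 = c.wY a)
  · exact (by ring : c.wO a + k * 0 = c.wO a)

lemma cot_wt_mom (a : c.Idx) : (c.cot k).wt (c.mom k a) = -c.wt a + k := by
  rcases a with a | a | a
  · exact (by ring : -0 + k * 1 = -0 + k)
  · exact (by ring : -c.wY a + k * 1 = -c.wY a + k)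
  · exact (by ring : -c.wO a + k * 1 = -c.wO a + k)

lemma hasWeight_coord (a : c.Idx) : c.HasWeight (c.wt a) (c.coord V a) :=
  eulerOf_coord (fun a => (c.wt a : ℝ)) a

lemma HasWeight.mul {v w : ℤ} {f g : c.Fn V} (hf : c.HasWeight v f) (hg : c.HasWeight w g) :
    c.HasWeight (v + w) (f * g) := by
  rw [HasWeight, Int.cast_add]
  exact eulerOf_mul (fun a => (c.wt a : ℝ)) hf hg

lemma HasWeight.smul {w : ℤ} {f : c.Fn V} (hf : c.HasWeight w f) (r : ℝ) :
    c.HasWeight w (r • f) := by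
  rw [HasWeight, map_smul, show c.euler V f = _ from hf, smul_comm]

lemma HasWeight.sum {w : ℤ} {ι : Type*} (s : Finset ι) {f : ι → c.Fn V}
    (h : ∀ i ∈ s, c.HasWeight w (f i)) : c.HasWeight w (∑ i ∈ s, f i) := by
  rw [HasWeight, map_sum, Finset.smul_sum]
  exact Finset.sum_congr rfl h

lemma HasWeight.congr {v w : ℤ} {f : c.Fn V} (hf : c.HasWeight v f) (h : v = w) :
    c.HasWeight w f := h ▸ hf

lemma HasWeight.pd {w : ℤ} {f : c.Fn V} (hf : c.HasWeight w f) (a : c.Idx) :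
    c.HasWeight (w - c.wt a) (c.pd V a f) := by
  rw [HasWeight, Int.cast_sub]
  exact eulerOf_pd (fun a => (c.wt a : ℝ)) hf a

lemma HasWeight.pull {w : ℤ} {f : c.Fn V} (hf : c.HasWeight w f) :
    (c.cot k).HasWeight w (c.pull V k f) := by
  have h := eulerOf_pull (V := V) (fun a => ((c.cot k).wt a : ℝ)) f
  simp only [cot_wt_pos] at h
  refine h.trans ?_
  rw [show c.eulerOf V (fun a => (c.wt a : ℝ)) f = _ from hf, map_smul]

lemma hasWeight_p (a : c.Idx) : (c.cot k).HasWeight (-c.wt a + k) (c.p V k a) := by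
  rw [← cot_wt_mom]
  exact hasWeight_coord _

lemma HasWeight.ham {n : ℕ} {F g : (c.cot k).Fn V} (hn : Homog ((c.cot k).sgn V) n F) {v w : ℤ}
    (hF : (c.cot k).HasWeight v F) (hg : (c.cot k).HasWeight w g) :
    (c.cot k).HasWeight (v + w - k) (c.ham V k F g) := by
  rw [HasWeight, Int.cast_sub, Int.cast_add]
  refine eulerOf_ham (ν := fun a => ((c.cot k).wt a : ℝ)) (fun a => ?_) hn hF hg
  rw [cot_wt_pos, cot_wt_mom]
  push_cast
  ring

lemma hasWeight_fieldHam {q : ℤ} (hQ : ∀ w f, c.HasWeight w f → c.HasWeight (w + q) (Q f)) :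
    (c.cot k).HasWeight (q + k) (c.fieldHam k Q) := by
  refine HasWeight.sum _ fun a _ => ?_
  exact ((hQ _ _ (hasWeight_coord a)).pull.mul (hasWeight_p a)).congr (by ring)

lemma hasWeight_bracketHam {s : ℤ}
    (hS : ∀ v w f g, c.HasWeight v f → c.HasWeight w g → c.HasWeight (v + w + s) (S f g)) :
    (c.cot k).HasWeight (s + 2 * k) (c.bracketHam k S) := by
  refine HasWeight.smul (HasWeight.sum _ fun a _ => HasWeight.sum _ fun b _ => ?_) _
  rw [← neg_smul]
  exact (((((hS _ _ _ _ (hasWeight_coord a) (hasWeight_coord b)).smul _).pull).mul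
    (hasWeight_p b)).mul (hasWeight_p a)).congr (by ring)

end Schouten

end Coords

namespace Coords

section CotangentLift

/-! ### Cotangent lifts of coordinate changes -/

variable {c c' c'' : Coords} {V : Opens (c.B → ℝ)} {V' : Opens (c'.B → ℝ)}
  {V'' : Opens (c''.B → ℝ)} {k : ℤ}

/-- The homomorphisms `φ` and `ψ` are mutually inverse and preserve parity and weight. -/
structure IsCoordChange (φ : c'.Fn V' →ₐ[ℝ] c.Fn V) (ψ : c.Fn V →ₐ[ℝ] c'.Fn V') : Prop where
  left_inv : ∀ f, ψ (φ f) = f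
  right_inv : ∀ f, φ (ψ f) = f
  sgn : ∀ f, c.sgn V (φ f) = φ (c'.sgn V' f)
  sgn_inv : ∀ f, c'.sgn V' (ψ f) = ψ (c.sgn V f)
  weight : ∀ w f, c'.HasWeight w f → c.HasWeight w (φ f)
  weight_inv : ∀ w f, c.HasWeight w f → c'.HasWeight w (ψ f)

lemma IsCoordChange.symm {φ : c'.Fn V' →ₐ[ℝ] c.Fn V} {ψ : c.Fn V →ₐ[ℝ] c'.Fn V'}
    (h : IsCoordChange φ ψ) : IsCoordChange ψ φ :=
  ⟨h.right_inv, h.left_inv, h.sgn_inv, h.sgn, h.weight_inv, h.weight⟩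

lemma IsCoordChange.homog {φ : c'.Fn V' →ₐ[ℝ] c.Fn V} {ψ : c.Fn V →ₐ[ℝ] c'.Fn V'}
    (h : IsCoordChange φ ψ) {n : ℕ} {f : c'.Fn V'} (hf : Homog (c'.sgn V') n f) :
    Homog (c.sgn V) n (φ f) := by
  rw [Homog, h.sgn, hf, map_smul]

/-- The transport of an operator along `φ` with inverse `ψ`. -/
def transport (φ : c'.Fn V' →ₐ[ℝ] c.Fn V) (ψ : c.Fn V →ₐ[ℝ] c'.Fn V')
    (D : c'.Fn V' →ₗ[ℝ] c'.Fn V') : c.Fn V →ₗ[ℝ] c.Fn V :=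
  φ.toLinearMap ∘ₗ D ∘ₗ ψ.toLinearMap

lemma transport_apply (φ : c'.Fn V' →ₐ[ℝ] c.Fn V) (ψ : c.Fn V →ₐ[ℝ] c'.Fn V')
    (D : c'.Fn V' →ₗ[ℝ] c'.Fn V') (f : c.Fn V) : transport φ ψ D f = φ (D (ψ f)) := rfl

lemma IsCoordChange.sder_transport {φ : c'.Fn V' →ₐ[ℝ] c.Fn V} {ψ : c.Fn V →ₐ[ℝ] c'.Fn V'}
    (h : IsCoordChange φ ψ) {m : ℕ} {D : c'.Fn V' →ₗ[ℝ] c'.Fn V'} (hD : SDer (c'.sgn V') m D) :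
    SDer (c.sgn V) m (transport φ ψ D) :=
  hD.conj ψ φ h.sgn_inv h.sgn h.right_inv

lemma IsCoordChange.superComm_transport {φ : c'.Fn V' →ₐ[ℝ] c.Fn V}
    {ψ : c.Fn V →ₐ[ℝ] c'.Fn V'} (h : IsCoordChange φ ψ) (m n : ℕ)
    (D E : c'.Fn V' →ₗ[ℝ] c'.Fn V') :
    superComm m n (transport φ ψ D) (transport φ ψ E) = transport φ ψ (superComm m n D E) := by
  refine LinearMap.ext fun f => ?_
  simp only [superComm_apply, transport_apply, h.left_inv, map_sub, map_smul]

/-- The homomorphism `Φ` is the cotangent lift of `φ` with inverse `ψ`: momenta are the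
Hamiltonians of the partial derivatives, and these are transported along `φ`. -/
structure IsCotLift (k : ℤ) (φ : c'.Fn V' →ₐ[ℝ] c.Fn V) (ψ : c.Fn V →ₐ[ℝ] c'.Fn V')
    (Φ : (c'.cot k).Fn V' →ₐ[ℝ] (c.cot k).Fn V) : Prop where
  base : ∀ f, Φ (c'.pull V' k f) = c.pull V k (φ f)
  momenta : ∀ b, Φ (c'.p V' k b) = c.fieldHam k (transport φ ψ (c'.pd V' b))

variable {φ : c'.Fn V' →ₐ[ℝ] c.Fn V} {ψ : c.Fn V →ₐ[ℝ] c'.Fn V'}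
  {Φ : (c'.cot k).Fn V' →ₐ[ℝ] (c.cot k).Fn V} {Ψ : (c.cot k).Fn V →ₐ[ℝ] (c'.cot k).Fn V'}

lemma IsCotLift.unique (h : IsCotLift k φ ψ Φ) {Φ' : (c'.cot k).Fn V' →ₐ[ℝ] (c.cot k).Fn V}
    (h' : IsCotLift k φ ψ Φ') : Φ' = Φ :=
  cot_algHom_ext k (fun f => by rw [h.base, h'.base]) fun b => by rw [h.momenta, h'.momenta]

lemma exists_isCotLift (h : IsCoordChange φ ψ) : ∃ Φ, IsCotLift k φ ψ Φ := by
  let z : (c'.cot k).Y ⊕ (c'.cot k).O → (c.cot k).Fn V := fun a =>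
    match a with
    | Sum.inl (Sum.inl y) => c.pull V k (φ (c'.coord V' (Sum.inr (Sum.inl y))))
    | Sum.inl (Sum.inr (Sum.inl b)) => c.fieldHam k (transport φ ψ (c'.pd V' (Sum.inl b)))
    | Sum.inl (Sum.inr (Sum.inr y)) =>
      c.fieldHam k (transport φ ψ (c'.pd V' (Sum.inr (Sum.inl y))))
    | Sum.inr (Sum.inl o) => c.pull V k (φ (c'.coord V' (Sum.inr (Sum.inr o))))
    | Sum.inr (Sum.inr o) => c.fieldHam k (transport φ ψ (c'.pd V' (Sum.inr (Sum.inr o))))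
  have hz : ∀ a, Homog ((c.cot k).sgn V) ((c'.cot k).par (Sum.inr a)) (z a) := by
    rintro ((y | b | y) | (o | o))
    · exact homog_pull k (h.homog (homog_coord (Sum.inr (Sum.inl y))))
    · exact homog_fieldHam (h.sder_transport (sder_pd (Sum.inl b)))
    · exact homog_fieldHam (h.sder_transport (sder_pd (Sum.inr (Sum.inl y))))
    · exact homog_pull k (h.homog (homog_coord (Sum.inr (Sum.inr o))))
    · exact homog_fieldHam (h.sder_transport (sder_pd (Sum.inr (Sum.inr o))))
  let β : Smooth c'.B V' →ₐ[ℝ] (c.cot k).Fn V := (c.pull V k).comp (φ.comp (c'.ofBase V'))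
  have hβ : ∀ s, Homog ((c.cot k).sgn V) 0 (β s) := fun s =>
    homog_pull k (h.homog (homog_ofBase s))
  obtain ⟨Φ, hB, hc⟩ := exists_algHom (c := c'.cot k) (V := V') isSuperComm β hβ z hz
  refine ⟨Φ, fun f => ?_, ?_⟩
  · refine DFunLike.congr_fun (f := Φ.comp (c'.pull V' k)) (g := (c.pull V k).comp φ)
      (algHom_ext (fun s => ?_) ?_) f
    · rw [AlgHom.comp_apply, pull_ofBase]
      exact hB s
    · intro a
      rw [AlgHom.comp_apply, pull_coord]
      rcases a with y | o
      · exact hc (Sum.inl (Sum.inl y))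
      · exact hc (Sum.inr (Sum.inl o))
  · rintro (b | y | o)
    · exact hc (Sum.inl (Sum.inr (Sum.inl b)))
    · exact hc (Sum.inl (Sum.inr (Sum.inr y)))
    · exact hc (Sum.inr (Sum.inr o))

lemma fieldHam_pd (a : c.Idx) : c.fieldHam k (c.pd V a) = c.p V k a := by
  classical
  rw [fieldHam, Finset.sum_eq_single a]
  · rw [pd_coord, if_pos rfl, map_one, one_mul]
  · intro b _ hb
    rw [pd_coord, if_neg hb.symm, map_zero, zero_mul]
  · intro h
    exact absurd (Finset.mem_univ _) h

namespace IsCotLift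

/-- The transformation law of the momenta extends to the Hamiltonians of all vector fields, by the
expansion of a field in partial derivatives. -/
lemma fieldHam (hΦ : IsCotLift k φ ψ Φ) {m : ℕ} {D : c'.Fn V' →ₗ[ℝ] c'.Fn V'}
    (hD : SDer (c'.sgn V') m D) :
    Φ (c'.fieldHam k D) = c.fieldHam k (transport φ ψ D) := by
  rw [Coords.fieldHam, map_sum]
  have h : ∀ b, Φ (c'.pull V' k (D (c'.coord V' b)) * c'.p V' k b) = ∑ a,
      c.pull V k (φ (D (c'.coord V' b) * c'.pd V' b (ψ (c.coord V a)))) * c.p V k a := fun b => by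
    rw [map_mul, hΦ.base, hΦ.momenta, Coords.fieldHam, Finset.mul_sum]
    refine Finset.sum_congr rfl fun a _ => ?_
    rw [transport_apply, map_mul, map_mul, mul_assoc]
  rw [Finset.sum_congr rfl fun b _ => h b, Finset.sum_comm, Coords.fieldHam]
  refine Finset.sum_congr rfl fun a _ => ?_
  rw [transport_apply, sder_apply hD, map_sum, map_sum, Finset.sum_mul]

lemma sgn (hΦ : IsCotLift k φ ψ Φ) (h : IsCoordChange φ ψ) (F : (c'.cot k).Fn V') :
    (c.cot k).sgn V (Φ F) = Φ ((c'.cot k).sgn V' F) := by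
  refine DFunLike.congr_fun (f := ((c.cot k).sgn V).comp Φ) (g := Φ.comp ((c'.cot k).sgn V'))
    (cot_algHom_ext k (fun f => ?_) fun b => ?_) F
  · rw [AlgHom.comp_apply, AlgHom.comp_apply, hΦ.base, ← pull_sgn, ← pull_sgn, hΦ.base, h.sgn]
  · rw [AlgHom.comp_apply, AlgHom.comp_apply, homog_p, map_smul, hΦ.momenta,
      homog_fieldHam (h.sder_transport (sder_pd b))]

lemma homog (hΦ : IsCotLift k φ ψ Φ) (h : IsCoordChange φ ψ) {n : ℕ} {F : (c'.cot k).Fn V'}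
    (hF : Homog ((c'.cot k).sgn V') n F) : Homog ((c.cot k).sgn V) n (Φ F) := by
  rw [Homog, hΦ.sgn h, hF, map_smul]

lemma comp (hΦ : IsCotLift k φ ψ Φ) {φ₁ : c''.Fn V'' →ₐ[ℝ] c'.Fn V'}
    {ψ₁ : c'.Fn V' →ₐ[ℝ] c''.Fn V''} (h₁ : IsCoordChange φ₁ ψ₁)
    {Φ₁ : (c''.cot k).Fn V'' →ₐ[ℝ] (c'.cot k).Fn V'} (hΦ₁ : IsCotLift k φ₁ ψ₁ Φ₁) :
    IsCotLift k (φ.comp φ₁) (ψ₁.comp ψ) (Φ.comp Φ₁) where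
  base f := by rw [AlgHom.comp_apply, hΦ₁.base, hΦ.base, AlgHom.comp_apply]
  momenta b := by
    rw [AlgHom.comp_apply, hΦ₁.momenta, hΦ.fieldHam (h₁.sder_transport (sder_pd b))]
    rfl

lemma id : IsCotLift k (AlgHom.id ℝ (c.Fn V)) (AlgHom.id ℝ (c.Fn V)) (AlgHom.id ℝ _) where
  base _ := rfl
  momenta b := (fieldHam_pd b).symm

lemma left_inv (hΦ : IsCotLift k φ ψ Φ) (hΨ : IsCotLift k ψ φ Ψ) (h : IsCoordChange φ ψ)
    (F : (c'.cot k).Fn V') : Ψ (Φ F) = F := by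
  have h1 := hΨ.comp h hΦ
  have h2 : ψ.comp φ = AlgHom.id ℝ _ := AlgHom.ext h.left_inv
  rw [h2] at h1
  exact DFunLike.congr_fun (IsCotLift.unique IsCotLift.id h1) F

/-- If the lifts of the coordinates are eigenvectors of the Euler field with the expected
eigenvalues, then the lift intertwines the Euler fields. -/
lemma eulerOf (hΦ : IsCotLift k φ ψ Φ) (hΨ : IsCotLift k ψ φ Ψ) (h : IsCoordChange φ ψ)
    {ν : (c.cot k).Idx → ℝ} {ν' : (c'.cot k).Idx → ℝ}
    (hz : ∀ z, (c.cot k).eulerOf V ν (Φ ((c'.cot k).coord V' z)) =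
      ν' z • Φ ((c'.cot k).coord V' z)) (F : (c'.cot k).Fn V') :
    (c.cot k).eulerOf V ν (Φ F) = Φ ((c'.cot k).eulerOf V' ν' F) := by
  have h1 := (sder_eulerOf ν).conj Φ Ψ (hΦ.sgn h) (hΨ.sgn h.symm) (hΦ.left_inv hΨ h)
  have h2 := sder_ext h1 (sder_eulerOf ν') fun z => by
    rw [LinearMap.comp_apply, LinearMap.comp_apply, AlgHom.toLinearMap_apply,
      AlgHom.toLinearMap_apply, hz, map_smul, hΦ.left_inv hΨ h, eulerOf_coord]
  rw [← LinearMap.congr_fun h2 F]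
  exact (hΨ.left_inv hΦ h.symm _).symm

lemma hasDeg (hΦ : IsCotLift k φ ψ Φ) (hΨ : IsCotLift k ψ φ Ψ) (h : IsCoordChange φ ψ)
    {r : ℝ} {F : (c'.cot k).Fn V'} (hF : HasDeg r F) : HasDeg r (Φ F) := by
  rw [HasDeg, hΦ.eulerOf hΨ h (ν' := c'.momDeg k) (fun z => ?_) F, hF, map_smul]
  obtain ⟨a, rfl⟩ | ⟨a, rfl⟩ := exists_pos_or_mom k z
  · rw [← pull_coord, hΦ.base, momDeg_pos]
    exact hasDeg_pull _
  · rw [momDeg_mom]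
    change HasDeg 1 (Φ (c'.p V' k a))
    rw [hΦ.momenta]
    exact hasDeg_fieldHam _

lemma hasWeight (hΦ : IsCotLift k φ ψ Φ) (hΨ : IsCotLift k ψ φ Ψ) (h : IsCoordChange φ ψ)
    {w : ℤ} {F : (c'.cot k).Fn V'} (hF : (c'.cot k).HasWeight w F) :
    (c.cot k).HasWeight w (Φ F) := by
  have h1 := hΦ.eulerOf hΨ h (ν := fun a => ((c.cot k).wt a : ℝ))
    (ν' := fun a => ((c'.cot k).wt a : ℝ)) (fun z => ?_) F
  · refine h1.trans ?_
    rw [show (c'.cot k).eulerOf V' (fun a => ((c'.cot k).wt a : ℝ)) F = _ from hF, map_smul]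
  obtain ⟨a, rfl⟩ | ⟨a, rfl⟩ := exists_pos_or_mom k z
  · rw [← pull_coord, hΦ.base, cot_wt_pos]
    exact (h.weight _ _ (hasWeight_coord a)).pull
  · change (c.cot k).HasWeight ((c'.cot k).wt (c'.mom k a)) (Φ (c'.p V' k a))
    rw [hΦ.momenta, cot_wt_mom]
    refine HasWeight.sum _ fun b _ => ?_
    exact ((h.weight _ _ ((h.weight_inv _ _ (hasWeight_coord b)).pd a)).pull.mul
      (hasWeight_p b)).congr (by ring)

/-- The cotangent lift is a canonical transformation. -/
lemma ham (hΦ : IsCotLift k φ ψ Φ) (hΨ : IsCotLift k ψ φ Ψ) (h : IsCoordChange φ ψ) {n : ℕ}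
    {F : (c'.cot k).Fn V'} (hF : Homog ((c'.cot k).sgn V') n F) (G : (c'.cot k).Fn V') :
    c.ham V k (Φ F) (Φ G) = Φ (c'.ham V' k F G) := by
  -- Both sides are superderivations in `G` (after transport), so `G` may be taken to be a
  -- coordinate. By antisymmetry the same then holds for `F`.
  have key : ∀ {n : ℕ} {F : (c'.cot k).Fn V'}, Homog ((c'.cot k).sgn V') n F →
      (∀ z, c.ham V k (Φ F) (Φ ((c'.cot k).coord V' z)) =
        Φ (c'.ham V' k F ((c'.cot k).coord V' z))) →
      ∀ G, c.ham V k (Φ F) (Φ G) = Φ (c'.ham V' k F G) := by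
    intro n F hF hz G
    have h1 := (sder_ham (hΦ.homog h hF)).conj Φ Ψ (hΦ.sgn h) (hΨ.sgn h.symm) (hΦ.left_inv hΨ h)
    have h2 := sder_ext h1 (sder_ham hF) fun z => by
      rw [LinearMap.comp_apply, LinearMap.comp_apply, AlgHom.toLinearMap_apply,
        AlgHom.toLinearMap_apply, hz, hΦ.left_inv hΨ h]
    rw [← LinearMap.congr_fun h2 G]
    exact (hΨ.left_inv hΦ h.symm _).symm
  have hmom : ∀ b f, c.ham V k (Φ (c'.p V' k b)) (Φ (c'.pull V' k f)) =
      Φ (c'.ham V' k (c'.p V' k b) (c'.pull V' k f)) := fun b f => by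
    rw [hΦ.momenta, hΦ.base, ham_fieldHam_pull (h.sder_transport (sder_pd b)), transport_apply,
      h.left_inv, ← fieldHam_pd, ham_fieldHam_pull (sder_pd b), hΦ.base]
  have hcoord : ∀ y G, c.ham V k (Φ ((c'.cot k).coord V' y)) (Φ G) =
      Φ (c'.ham V' k ((c'.cot k).coord V' y) G) := by
    intro y
    refine key (homog_coord y) fun z => ?_
    obtain ⟨a, rfl⟩ | ⟨a, rfl⟩ := exists_pos_or_mom k y <;>
    obtain ⟨b, rfl⟩ | ⟨b, rfl⟩ := exists_pos_or_mom k z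
    · have ha := homog_coord (V := V') a
      rw [← pull_coord, ← pull_coord, hΦ.base, hΦ.base, ham_pull_pull ha,
        ham_pull_pull (h.homog ha), map_zero]
    · have ha := homog_pull k (homog_coord (V := V') a)
      have hb := homog_p (V := V') k b
      rw [← pull_coord]
      change c.ham V k _ (Φ (c'.p V' k b)) = Φ (c'.ham V' k _ (c'.p V' k b))
      rw [ham_antisymm (hΦ.homog h ha) (hΦ.homog h hb), ham_antisymm ha hb, hmom, map_neg,
        map_smul]
    · rw [← pull_coord]
      exact hmom a _
    · change c.ham V k (Φ (c'.p V' k a)) (Φ (c'.p V' k b)) =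
        Φ (c'.ham V' k (c'.p V' k a) (c'.p V' k b))
      rw [hΦ.momenta, hΦ.momenta, ham_fieldHam_fieldHam (h.sder_transport (sder_pd a))
        (h.sder_transport (sder_pd b)), h.superComm_transport, ← fieldHam_pd, ← fieldHam_pd,
        ham_fieldHam_fieldHam (sder_pd a) (sder_pd b),
        hΦ.fieldHam ((sder_pd a).superComm (sder_pd b))]
  refine key hF (fun z => ?_) G
  rw [ham_antisymm (hΦ.homog h hF) (hΦ.homog h (homog_coord z)), hcoord,
    ham_antisymm hF (homog_coord z), map_neg, map_smul]

/-- The lift preserves the Hamiltonian of the Schouten bracket, which is quadratic in the momenta and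
therefore determined by its brackets with the coordinates of the base. -/
lemma bracketHam (hΦ : IsCotLift k φ ψ Φ) (hΨ : IsCotLift k ψ φ Ψ) (h : IsCoordChange φ ψ)
    {S : c.Fn V →ₗ[ℝ] c.Fn V →ₗ[ℝ] c.Fn V} {S' : c'.Fn V' →ₗ[ℝ] c'.Fn V' →ₗ[ℝ] c'.Fn V'}
    (hS : IsOddPoisson (c.sgn V) S) (hS' : IsOddPoisson (c'.sgn V') S')
    (hSS' : ∀ f g, S (φ f) (φ g) = φ (S' f g)) :
    Φ (c'.bracketHam k S') = c.bracketHam k S := by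
  have hH' := homog_bracketHam (k := k) hS'
  refine eq_of_ham_pos (hΦ.homog h hH') (homog_bracketHam hS) two_ne_zero
    (hΦ.hasDeg hΨ h hasDeg_bracketHam) hasDeg_bracketHam fun a => ?_
  have ha := h.symm.homog (homog_coord (V := V) a)
  have h1 : c.pull V k (c.coord V a) = Φ (c'.pull V' k (ψ (c.coord V a))) := by
    rw [hΦ.base, h.right_inv]
  have h2 : transport φ ψ (S' (ψ (c.coord V a))) = S (c.coord V a) := LinearMap.ext fun f => by
    rw [transport_apply, ← hSS', h.right_inv, h.right_inv]
  rw [ham_bracketHam_coord hS, h1, hΦ.ham hΨ h hH', ham_bracketHam_pull hS' ha, map_neg, map_smul,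
    hΦ.fieldHam (hS'.sder isSuperComm ha), h2]

end IsCotLift

end CotangentLift

section Restriction

/-! ### Restriction and value on the base of cotangent functions -/

variable {c : Coords} {V V' : Opens (c.B → ℝ)} {k : ℤ}

lemma res_sgn_pow (h : V' ≤ V) (n : ℕ) (f : c.Fn V) :
    c.res h ((c.sgn V ^ n) f) = (c.sgn V' ^ n) (c.res h f) := by
  induction n generalizing f with
  | zero => rfl
  | succ n ih => rw [pow_succ, pow_succ, AlgHom.mul_apply, AlgHom.mul_apply, ih, res_sgn]

lemma res_ham (h : V' ≤ V) (H f : (c.cot k).Fn V) :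
    (c.cot k).res h (c.ham V k H f) =
      c.ham V' k ((c.cot k).res h H) ((c.cot k).res h f) := by
  simp only [ham, LinearMap.sum_apply, map_sum]
  refine Finset.sum_congr rfl fun a _ => ?_
  simp only [LinearMap.sub_apply, LinearMap.smul_apply, LinearMap.comp_apply,
    LinearMap.mulLeft_apply, map_sub, map_smul, map_mul, res_pd, res_sgn_pow]

lemma res_p (h : V' ≤ V) (a : c.Idx) : (c.cot k).res h (c.p V k a) = c.p V' k a :=
  res_coord (c := c.cot k) h _

lemma res_fieldHam (h : V' ≤ V) {D : c.Fn V →ₗ[ℝ] c.Fn V} {D' : c.Fn V' →ₗ[ℝ] c.Fn V'}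
    (hD : ∀ f, D' (c.res h f) = c.res h (D f)) :
    (c.cot k).res h (c.fieldHam k D) = c.fieldHam k D' := by
  rw [fieldHam, fieldHam, map_sum]
  refine Finset.sum_congr rfl fun a _ => ?_
  rw [map_mul, res_p, res_pull, ← hD, res_coord]

lemma res_bracketHam (h : V' ≤ V) {S : c.Fn V →ₗ[ℝ] c.Fn V →ₗ[ℝ] c.Fn V}
    {S' : c.Fn V' →ₗ[ℝ] c.Fn V' →ₗ[ℝ] c.Fn V'}
    (hS : ∀ f g, S' (c.res h f) (c.res h g) = c.res h (S f g)) :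
    (c.cot k).res h (c.bracketHam k S) = c.bracketHam k S' := by
  rw [bracketHam, bracketHam, map_smul, map_sum]
  congr 1
  refine Finset.sum_congr rfl fun a _ => ?_
  rw [map_sum]
  refine Finset.sum_congr rfl fun b _ => ?_
  rw [map_mul, map_mul, res_p, res_p, res_pull, map_neg, map_smul, ← hS, res_coord, res_coord]

lemma body_ofBase (s : Smooth c.B V) : c.body V (c.ofBase V s) = s := by
  refine (Algebra.TensorProduct.lift_tmul _ _ _ s 1).trans ?_
  rw [map_one, mul_one]
  rfl

lemma body_coord (a : c.Y ⊕ c.O) : c.body V (c.coord V (Sum.inr a)) = 0 := by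
  rcases a with y | o
  · refine (Algebra.TensorProduct.lift_tmul _ _ _ 1 _).trans ?_
    rw [map_one, one_mul, AlgHom.comp_apply, Algebra.TensorProduct.lift_tmul, MvPolynomial.aeval_X,
      zero_mul, map_zero]
  · refine (Algebra.TensorProduct.lift_tmul _ _ _ 1 _).trans ?_
    rw [map_one, one_mul, AlgHom.comp_apply, Algebra.TensorProduct.lift_tmul]
    simp [ExteriorAlgebra.algebraMapInv]

lemma body_pull (f : c.Fn V) : (c.cot k).body V (c.pull V k f) = c.body V f := by
  refine DFunLike.congr_fun (f := ((c.cot k).body V).comp (c.pull V k)) (g := c.body V)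
    (algHom_ext (fun s => ?_) fun a => ?_) f
  · rw [AlgHom.comp_apply, pull_ofBase, body_ofBase]
    exact (body_ofBase s).symm
  · rw [AlgHom.comp_apply, pull_coord, body_coord]
    rcases a with y | o
    · exact body_coord (c := c.cot k) (Sum.inl (Sum.inl y))
    · exact body_coord (c := c.cot k) (Sum.inr (Sum.inl o))

lemma IsCotLift.res {c' : Coords} {U U' : Opens (c'.B → ℝ)} {hV : V' ≤ V} {hU : U' ≤ U}
    {φ : c'.Fn U →ₐ[ℝ] c.Fn V} {ψ : c.Fn V →ₐ[ℝ] c'.Fn U} {φ' : c'.Fn U' →ₐ[ℝ] c.Fn V'}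
    {ψ' : c.Fn V' →ₐ[ℝ] c'.Fn U'} {Φ : (c'.cot k).Fn U →ₐ[ℝ] (c.cot k).Fn V}
    {Φ' : (c'.cot k).Fn U' →ₐ[ℝ] (c.cot k).Fn V'} (hΦ : IsCotLift k φ ψ Φ)
    (hΦ' : IsCotLift k φ' ψ' Φ') (hφ : ∀ f, φ' (c'.res hU f) = c.res hV (φ f))
    (hψ : ∀ f, ψ' (c.res hV f) = c'.res hU (ψ f)) (F : (c'.cot k).Fn U) :
    Φ' ((c'.cot k).res hU F) = (c.cot k).res hV (Φ F) := by
  refine DFunLike.congr_fun (f := Φ'.comp ((c'.cot k).res hU)) (g := ((c.cot k).res hV).comp Φ)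
    (cot_algHom_ext k (fun f => ?_) fun b => ?_) F
  · rw [AlgHom.comp_apply, AlgHom.comp_apply, res_pull, hΦ.base, hΦ'.base, res_pull, hφ]
  · rw [AlgHom.comp_apply, AlgHom.comp_apply, res_p, hΦ.momenta, hΦ'.momenta]
    refine (res_fieldHam hV fun f => ?_).symm
    rw [transport_apply, transport_apply, hψ, ← res_pd, hφ]

end Restriction

end Coords

section CotangentManifold

/-! ### The cotangent bundle of a graded manifold -/

variable {X : Type*} [TopologicalSpace X] {ι : Type*} {c : ι → GChart X} {φ : Transitions c}

lemma IsGradedAtlas.isCoordChange (hM : IsGradedAtlas c φ) (i j : ι) (W : Opens X)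
    (hi : W ≤ (c i).dom) (hj : W ≤ (c j).dom) :
    Coords.IsCoordChange (φ i j W hi hj) (φ j i W hj hi) := by
  have hinv : ∀ (i j : ι) (hi : W ≤ (c i).dom) (hj : W ≤ (c j).dom) (f : (c j).Fn W),
      φ j i W hj hi (φ i j W hi hj f) = f := fun i j hi hj f => by
    rw [hM.cocycle, hM.id]
  have hsgn : ∀ (i j : ι) (hi : W ≤ (c i).dom) (hj : W ≤ (c j).dom) (f : (c j).Fn W),
      (c i).coords.sgn _ (φ i j W hi hj f) = φ i j W hi hj ((c j).coords.sgn _ f) := by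
    intro i j hi hj f
    refine Coords.isSuperComm.induction_homog (p := fun f => (c i).coords.sgn _ (φ i j W hi hj f) =
      φ i j W hi hj ((c j).coords.sgn _ f)) (fun n f hf => ?_) (fun f g hf hg => ?_) f
    · rw [hf, map_smul]
      exact hM.map_par i j W hi hj n f hf
    · rw [map_add, map_add, map_add, map_add, hf, hg]
  exact ⟨hinv i j hi hj, hinv j i hj hi, hsgn i j hi hj, hsgn j i hj hi,
    hM.map_weight i j W hi hj, hM.map_weight j i W hj hi⟩

lemma isCotangent_iff {k : ℤ} {Φ : Transitions (cotCharts c k)} : IsCotangent c φ k Φ ↔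
    ∀ (i j : ι) (W : Opens X) (hi : W ≤ (c i).dom) (hj : W ≤ (c j).dom),
      Coords.IsCotLift k (φ i j W hi hj) (φ j i W hj hi) (Φ i j W hi hj) :=
  ⟨fun h i j W hi hj => ⟨h.base i j W hi hj, h.momenta i j W hi hj⟩,
    fun h => ⟨fun i j W hi hj => (h i j W hi hj).base, fun i j W hi hj => (h i j W hi hj).momenta⟩⟩

lemma IsCotangent.unique {k : ℤ} {Φ Φ' : Transitions (cotCharts c k)}
    (h : IsCotangent c φ k Φ) (h' : IsCotangent c φ k Φ') : Φ' = Φ := by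
  rw [isCotangent_iff] at h h'
  funext i j W hi hj
  exact (h i j W hi hj).unique (h' i j W hi hj)

lemma exists_isCotangent (hM : IsGradedAtlas c φ) (k : ℤ) :
    ∃ Φ : Transitions (cotCharts c k), IsCotangent c φ k Φ := by
  choose Φ hΦ using fun (i j : ι) (W : Opens X) (hi : W ≤ (c i).dom) (hj : W ≤ (c j).dom) =>
    Coords.exists_isCotLift (k := k) (hM.isCoordChange i j W hi hj)
  exact ⟨Φ, isCotangent_iff.2 hΦ⟩

lemma IsCotangent.isGradedAtlas (hM : IsGradedAtlas c φ) {k : ℤ}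
    {Φ : Transitions (cotCharts c k)} (hΦ : IsCotangent c φ k Φ) :
    IsGradedAtlas (cotCharts c k) Φ where
  cover := hM.cover
  map_res i j W W' hi hj h f := by
    have hl := isCotangent_iff.1 hΦ
    exact (hl i j W hi hj).res (hl i j W' (h.trans hi) (h.trans hj))
      (hV := (c i).im_mono h) (hU := (c j).im_mono h)
      (hM.map_res i j W W' hi hj h) (hM.map_res j i W W' hj hi h) f
  map_body i j W hi hj f x hx := by
    have h1 : Φ i j W hi hj (((c j).coords.cot k).ofBase _ f) =
        (c i).coords.pull _ k (φ i j W hi hj ((c j).coords.ofBase _ f)) :=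
      (congrArg _ (Coords.pull_ofBase k _).symm).trans (hΦ.base i j W hi hj _)
    have h2 : ((c i).coords.cot k).body _ (Φ i j W hi hj (((c j).coords.cot k).ofBase _ f)) =
        (c i).coords.body _ (φ i j W hi hj ((c j).coords.ofBase _ f)) := by
      refine Eq.trans ?_ (Coords.body_pull (k := k) _)
      exact congrArg _ h1
    have h3 := hM.map_body i j W hi hj f x hx
    rw [← h2] at h3
    exact h3
  map_par i j W hi hj n f hf :=
    (isCotangent_iff.1 hΦ i j W hi hj).homog (hM.isCoordChange i j W hi hj) hf
  map_weight i j W hi hj w f hf :=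
    (isCotangent_iff.1 hΦ i j W hi hj).hasWeight (isCotangent_iff.1 hΦ j i W hj hi)
      (hM.isCoordChange i j W hi hj) hf
  id i W hi f := by
    have h1 := isCotangent_iff.1 hΦ i i W hi hi
    have h2 : φ i i W hi hi = AlgHom.id ℝ _ := AlgHom.ext (hM.id i W hi)
    rw [h2] at h1
    exact DFunLike.congr_fun (Coords.IsCotLift.unique Coords.IsCotLift.id h1) f
  cocycle i j l W hi hj hl f := by
    have hc := isCotangent_iff.1 hΦ
    have h1 := (hc i j W hi hj).comp (hM.isCoordChange j l W hj hl) (hc j l W hj hl)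
    have h2 : (φ i j W hi hj).comp (φ j l W hj hl) = φ i l W hi hl :=
      AlgHom.ext (hM.cocycle i j l W hi hj hl)
    have h3 : (φ l j W hl hj).comp (φ j i W hj hi) = φ l i W hl hi :=
      AlgHom.ext (hM.cocycle l j i W hl hj hi)
    rw [h2, h3] at h1
    exact DFunLike.congr_fun ((hc i l W hi hl).unique h1) f

/-! ### The homological vector field of the double -/

lemma IsVectorField.sder {m : ℕ} {D : Operators c} (hD : IsVectorField c φ m D) (i : ι)
    (W : Opens X) (hi : W ≤ (c i).dom) : SDer ((c i).coords.sgn _) m (D i W hi) :=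
  SDer.of_homog Coords.isSuperComm (hD.map_par i W hi) (hD.leibniz i W hi)

lemma IsSchouten.isOddPoisson {S : Operations c} (hS : IsSchouten c φ S) (i : ι) (W : Opens X)
    (hi : W ≤ (c i).dom) : IsOddPoisson ((c i).coords.sgn _) (S i W hi) :=
  ⟨hS.map_par i W hi, hS.antisymm i W hi, hS.jacobi i W hi, hS.leibniz i W hi⟩

variable {q s : ℤ} {Q : Operators c} {S : Operations c}

lemma doubleField_eq (k : ℤ) (l : ℝ) : doubleField c k Q S l = fun i W hi =>
    (c i).coords.ham _ k ((c i).coords.doubleHam k (Q i W hi) (S i W hi) l) := by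
  funext i W hi
  exact (Coords.ham_doubleHam l).symm

lemma IsGradedQS.isHomological_doubleField (hQS : IsGradedQS c φ q s Q S)
    (hM : IsGradedAtlas c φ) {k : ℤ} {Φ : Transitions (cotCharts c k)}
    (hΦ : IsCotangent c φ k Φ) (l : ℝ) :
    IsHomological (cotCharts c k) Φ (doubleField c k Q S l) := by
  have hQ := hQS.homological.toIsVectorField
  have hS := hQS.schouten
  have hH : ∀ i W hi, Homog _ 1 ((c i).coords.doubleHam k (Q i W hi) (S i W hi) l) :=
    fun i W hi => Coords.homog_doubleHam (hQ.sder i W hi) (hS.isOddPoisson i W hi) l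
  have hc := isCotangent_iff.1 hΦ
  have htr : ∀ (i j : ι) (W : Opens X) (hi : W ≤ (c i).dom) (hj : W ≤ (c j).dom),
      Coords.transport (φ i j W hi hj) (φ j i W hj hi) (Q j W hj) = Q i W hi :=
    fun i j W hi hj => LinearMap.ext fun f => by
      rw [Coords.transport_apply, ← hQ.map_transition, (hM.isCoordChange i j W hi hj).right_inv]
  have hres : ∀ (i : ι) (W W' : Opens X) (hi : W ≤ (c i).dom) (h : W' ≤ W),
      ((c i).coords.cot k).res ((c i).im_mono h)
        ((c i).coords.doubleHam k (Q i W hi) (S i W hi) l) =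
      (c i).coords.doubleHam k (Q i W' (h.trans hi)) (S i W' (h.trans hi)) l := by
    intro i W W' hi h
    rw [Coords.doubleHam, Coords.doubleHam, map_add, map_smul,
      Coords.res_fieldHam _ (hQ.map_res i W W' hi h),
      Coords.res_bracketHam _ (hS.map_res i W W' hi h)]
  rw [doubleField_eq]
  refine ⟨⟨fun i W W' hi h f => ?_, fun i j W hi hj f => ?_, fun i W hi n f hf => ?_,
    fun i W hi n f g hf => ?_⟩, fun i W hi f => ?_⟩
  · refine Eq.trans ?_ (Coords.res_ham ((c i).im_mono h) _ f).symm
    exact congrArg (fun H => (c i).coords.ham _ k H _) (hres i W W' hi h).symm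
  · have hcc := hM.isCoordChange i j W hi hj
    have h1 := ((hc i j W hi hj).fieldHam (hQ.sder j W hj)).trans
      (congrArg _ (htr i j W hi hj))
    have h2 := (hc i j W hi hj).bracketHam (hc j i W hj hi) hcc (hS.isOddPoisson i W hi)
      (hS.isOddPoisson j W hj) (hS.map_transition i j W hi hj)
    have h3 : Φ i j W hi hj ((c j).coords.doubleHam k (Q j W hj) (S j W hj) l) =
        (c i).coords.doubleHam k (Q i W hi) (S i W hi) l :=
      (map_add _ _ _).trans (congrArg₂ _ h1 ((map_smul _ _ _).trans (congrArg _ h2)))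
    refine Eq.trans ?_ ((hc i j W hi hj).ham (hc j i W hj hi) hcc (hH j W hj) f)
    exact congrArg (fun H => (c i).coords.ham _ k H _) h3.symm
  · exact (Coords.sder_ham (hH i W hi)).homog hf
  · exact (Coords.sder_ham (hH i W hi)).leibniz_homog hf g
  · exact Coords.ham_doubleHam_sq (hQ.sder i W hi) (hQS.homological.sq_zero i W hi)
      (hS.isOddPoisson i W hi) (hQS.derivation i W hi) l f

/-- The Hamiltonians have the weights `q + k` and `s + 2 k`, and the Poisson bracket has weight
`-k`. For `k = q - s` both Hamiltonian vector fields have weight `q`. -/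
lemma IsGradedQS.hasWeight_doubleField (hQS : IsGradedQS c φ q s Q S) (l : ℝ) :
    FieldHasWeight (cotCharts c (q - s)) q (doubleField c (q - s) Q S l) := by
  rw [doubleField_eq]
  intro i W hi w f hf
  have h1 := Coords.hasWeight_fieldHam (k := q - s) (hQS.field_weight i W hi)
  have h2 := (Coords.hasWeight_bracketHam (k := q - s) (hQS.bracket_weight i W hi)).congr
    (show s + 2 * (q - s) = q + (q - s) by ring)
  have hH := Coords.homog_doubleHam (k := q - s)
    (hQS.homological.toIsVectorField.sder i W hi) (hQS.schouten.isOddPoisson i W hi) l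
  have h3 : ((c i).coords.cot (q - s)).HasWeight (q + (q - s))
      ((c i).coords.doubleHam (q - s) (Q i W hi) (S i W hi) l) := by
    rw [Coords.HasWeight, Coords.doubleHam, map_add, map_smul, show Coords.euler _ _ _ = _ from h1,
      show Coords.euler _ _ _ = _ from h2, smul_add, smul_comm l]
  exact (Coords.HasWeight.ham hH h3 hf).congr (by ring)

end CotangentManifold

end GradedGeometry

end

theorem theorem5p1 {X : Type*} [TopologicalSpace X] {ι : Type*}
    (c : ι → GradedGeometry.GChart X) (φ : GradedGeometry.Transitions c)
    (hM : GradedGeometry.IsGradedAtlas c φ)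
    (q s : ℤ) (Q : GradedGeometry.Operators c) (S : GradedGeometry.Operations c)
    (hQS : GradedGeometry.IsGradedQS c φ q s Q S) :
    ∃ Φ : GradedGeometry.Transitions (GradedGeometry.cotCharts c (q - s)),
      GradedGeometry.IsCotangent c φ (q - s) Φ ∧
      (∀ Φ' : GradedGeometry.Transitions (GradedGeometry.cotCharts c (q - s)),
        GradedGeometry.IsCotangent c φ (q - s) Φ' → Φ' = Φ) ∧
      GradedGeometry.IsGradedAtlas (GradedGeometry.cotCharts c (q - s)) Φ ∧
      ∀ l : ℝ,
        GradedGeometry.IsHomological (GradedGeometry.cotCharts c (q - s)) Φ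
          (GradedGeometry.doubleField c (q - s) Q S l) ∧
        GradedGeometry.FieldHasWeight (GradedGeometry.cotCharts c (q - s)) q
          (GradedGeometry.doubleField c (q - s) Q S l) := by
  obtain ⟨Φ, hΦ⟩ := GradedGeometry.exists_isCotangent hM (q - s)
  exact ⟨Φ, hΦ, fun Φ' hΦ' => hΦ.unique hΦ', hΦ.isGradedAtlas hM, fun l =>
    ⟨hQS.isHomological_doubleField hM hΦ l, hQS.hasWeight_doubleField l⟩⟩
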